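/- Let $N,d\ge 1$. Write $x=(x_1,\dots,x_N)$ for points of $\mathbb R^{Nd}\cong(\mathbb R^d)^N$ and $A_{s,t}\in\mathbb R^{d\times d}$ for the blocks of $A\in\mathbb R^{Nd\times Nd}$; let $\mathscr L(N,d)$ be the set of block lower triangular matrices ($L_{s,t}=0$ for $s<t$). Let $\|C\|_F=\sqrt{\operatorname{tr}(CC^\top)}$, $\|C\|_*=\operatorname{tr}((C^\top C)^{1/2})$, and let $\|C\|_{2\to2}$ be the spectral norm. For $a\in\mathbb R^{Nd}$, $L\in\mathscr L(N,d)$ the filtered Gaussian process $\mathbb G^{a,L}$ is the probability space $(\mathbb R^{Nd},\mathcal B,\mathcal N(0,I))$ with the filtration $\mathcal F_t=\sigma(\epsilon_1,\dots,\epsilon_t)$ generated by the canonical process $\epsilon$, together with the process $X=a+L\epsilon$. A bicausal coupling of two filtered processes $\mathbb X,\mathbb Y$ is a probability measure $\pi$ on the product of the underlying spaces, with the two underlying probability measures as marginals, such that for every $1\le t\le N$, under $\pi$, $\mathcal F^{\mathbb X}_N$ and $\mathcal F^{\mathbb Y}_t$ are conditionally independent given $\mathcal F^{\mathbb X}_t$,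 and $\mathcal F^{\mathbb Y}_N$ and $\mathcal F^{\mathbb X}_t$ are conditionally independent given $\mathcal F^{\mathbb Y}_t$. Let $\mathcal{AW}_2(\mathbb X,\mathbb Y)=\inf_\pi \mathbb E_\pi[\|X-Y\|_2^2]^{1/2}$ over all bicausal couplings; $\pi$ is optimal if it is bicausal and attains the infimum. For $P=\operatorname{diag}(P_1,\dots,P_N)$ with $P_t\in\mathbb R^{d\times d}$, $\|P_t\|_{2\to2}\le1$, let $\pi^P$ be the centred Gaussian law of $(\epsilon^X,\epsilon^Y)\in\mathbb R^{Nd}\times\mathbb R^{Nd}$ with $\operatorname{Cov}(\epsilon^X)=\operatorname{Cov}(\epsilon^Y)=I$ and $\mathbb E[\epsilon^Y(\epsilon^X)^\top]=P$, i.e. with covariance matrix $\begin{bmatrix}I&P^\top\\P&I\end{bmatrix}$. For $C\in\mathbb R^{d\times d}$ let $\mathscr P(C)$ be the set of maximizers of $\operatorname{tr}(CP)$ over $P\in\mathbb R^{d\times d}$ with $\|P\|_{2\to2}\le1$. **Theorem.** Let $a,b\in\mathbb R^{Nd}$ and $L,M\in\mathscr L(N,d)$. (i) $\mathcal{AW}_2^2(\mathbb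 G^{a,L},\mathbb G^{b,M})=\|a-b\|_2^2+\mathrm{dist}_{AW}^2(L,M)$, where $$\mathrm{dist}_{AW}(L,M)=\Big(\|L\|_F^2+\|M\|_F^2-2\sum_{t=1}^N\|(L^\top M)_{t,t}\|_*\Big)^{1/2},$$ the quantity under the root being nonnegative. The function $\mathrm{dist}_{AW}$ is a pseudo-metric on $\mathscr L(N,d)$; hence $L\sim M\iff\mathrm{dist}_{AW}(L,M)=0$ is an equivalence relation and $\mathrm{dist}_{AW}$ induces a metric on $\mathscr L(N,d)/\!\sim$. (ii) There is a Gaussian bicausal coupling that is optimal for $\mathcal{AW}_2(\mathbb G^{a,L},\mathbb G^{b,M})$. For every $P=\operatorname{diag}(P_1,\dots,P_N)$ with $\|P_t\|_{2\to2}\le 1$ for all $t$, $\pi^P$ is a Gaussian bicausal coupling, and it is optimal if and only if $P_t\in\mathscr P((L^\top M)_{t,t})$ for all $t$. If $(L^\top M)_{t,t}=U_t\Sigma_tV_t^\top$ are singular value decompositions, then $$\mathscr P((L^\top M)_{t,t})=\{V_{t,1}U_{t,1}^\top+V_{t,0}KU_{t,0}^\top:\|K\|_{2\to2}\le1\},$$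 where $U_{t,1},V_{t,1}$ (resp. $U_{t,0},V_{t,0}$) consist of the columns of $U_t,V_t$ that belong to the nonzero (resp. zero) singular values. In particular $P_t=V_tU_t^\top$ gives an optimal $\pi^P$ for which $P$ is block diagonal with orthogonal diagonal blocks. -/

import Mathlib

open MeasureTheory ProbabilityTheory
open scoped ENNReal Matrix MatrixOrder

noncomputable section

namespace AdaptedOT

/-! ### Filtered processes and adapted optimal transport -/

/-- The path space `ℝ^{Nd} ≅ (ℝ^d)^N` with its Euclidean norm; the coordinate `(t, i)` is the
`i`-th coordinate of the `t`-th temporal block. -/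
abbrev PathSpace (N d : ℕ) : Type := EuclideanSpace ℝ (Fin N × Fin d)

/-- The `t`-th temporal block `x_t ∈ ℝ^d` of a path `x`. -/
def timeBlock {N d : ℕ} (t : Fin N) (x : PathSpace N d) : EuclideanSpace ℝ (Fin d) :=
  WithLp.toLp 2 fun i => x (t, i)

/-- A filtered process: a filtered probability space (time runs through `Fin N`, that is, through
`N` time steps) with an adapted `ℝ^d`-valued process whose law has a finite second moment. -/
structure FilteredProcess (N d : ℕ) where
  Ω : Type
  mΩ : MeasurableSpace Ω
  P : Measure Ω
  isProb : IsProbabilityMeasure P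
  ℱ : Filtration (Fin N) mΩ
  X : Fin N → Ω → EuclideanSpace ℝ (Fin d)
  adapted : Adapted ℱ X
  memLp : ∀ t, MemLp (X t) 2 P

attribute [instance] FilteredProcess.mΩ FilteredProcess.isProb

/-- The whole path `X = (X_1, …, X_N)` as a random element of `ℝ^{Nd}`. -/
def FilteredProcess.path {N d : ℕ} (𝕏 : FilteredProcess N d) (ω : 𝕏.Ω) : PathSpace N d :=
  WithLp.toLp 2 fun p => 𝕏.X p.1 ω p.2

/-- Conditional independence of the sub-σ-algebras `m₁` and `m₂` given the sub-σ-algebra `m`,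
in terms of conditional probabilities: `μ(A ∩ B | m) = μ(A | m) μ(B | m)` almost surely for
`A ∈ m₁`, `B ∈ m₂`. No assumption is made on the underlying measurable space. -/
def CondIndepGiven {Ω : Type*} (m m₁ m₂ : MeasurableSpace Ω) {_mΩ : MeasurableSpace Ω}
    (μ : Measure Ω) : Prop :=
  ∀ A B : Set Ω, MeasurableSet[m₁] A → MeasurableSet[m₂] B →
    (μ⟦A ∩ B | m⟧) =ᵐ[μ] (μ⟦A | m⟧) * (μ⟦B | m⟧)

/-- Bicausal couplings of two filtered processes. Here `(𝕏.ℱ t).prod ⊥` is the product of `ℱ_t^𝕏`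
with the trivial σ-algebra, and `⊤ : Fin N` is the last time step. -/
structure IsBicausalCoupling {N d : ℕ} [NeZero N] (𝕏 𝕐 : FilteredProcess N d)
    (π : Measure (𝕏.Ω × 𝕐.Ω)) : Prop where
  isProb : IsProbabilityMeasure π
  fst_eq : π.fst = 𝕏.P
  snd_eq : π.snd = 𝕐.P
  causal : ∀ t : Fin N, CondIndepGiven
    (MeasurableSpace.prod (𝕏.ℱ t) ⊥)
    (MeasurableSpace.prod (𝕏.ℱ ⊤) ⊥)
    (MeasurableSpace.prod ⊥ (𝕐.ℱ t)) π
  anticausal : ∀ t : Fin N, CondIndepGiven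
    (MeasurableSpace.prod ⊥ (𝕐.ℱ t))
    (MeasurableSpace.prod ⊥ (𝕐.ℱ ⊤))
    (MeasurableSpace.prod (𝕏.ℱ t) ⊥) π

/-- The transport cost `E_π[‖X - Y‖²]`. -/
def transportCost {N d : ℕ} (𝕏 𝕐 : FilteredProcess N d) (π : Measure (𝕏.Ω × 𝕐.Ω)) : ℝ≥0∞ :=
  ∫⁻ ω, ‖𝕏.path ω.1 - 𝕐.path ω.2‖ₑ ^ 2 ∂π

/-- The adapted `2`-Wasserstein distance. -/
def AW2 {N d : ℕ} [NeZero N] (𝕏 𝕐 : FilteredProcess N d) : ℝ≥0∞ :=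
  ⨅ (π : Measure (𝕏.Ω × 𝕐.Ω)) (_ : IsBicausalCoupling 𝕏 𝕐 π),
    transportCost 𝕏 𝕐 π ^ (1 / 2 : ℝ)

/-- `π` is a bicausal coupling that attains the adapted `2`-Wasserstein distance. -/
def IsOptimalCoupling {N d : ℕ} [NeZero N] (𝕏 𝕐 : FilteredProcess N d)
    (π : Measure (𝕏.Ω × 𝕐.Ω)) : Prop :=
  IsBicausalCoupling 𝕏 𝕐 π ∧ transportCost 𝕏 𝕐 π ^ (1 / 2 : ℝ) = AW2 𝕏 𝕐

/-! ### Matrices -/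

/-- Real `Nd × Nd` matrices, indexed by pairs (time, space). -/
abbrev PathMatrix (N d : ℕ) : Type := Matrix (Fin N × Fin d) (Fin N × Fin d) ℝ

/-- The `(s, t)`-th temporal block `A_{s,t} ∈ ℝ^{d × d}`. -/
def matBlock {N d : ℕ} (A : PathMatrix N d) (s t : Fin N) : Matrix (Fin d) (Fin d) ℝ :=
  Matrix.of fun i j => A (s, i) (t, j)

/-- The block diagonal matrix `diag(P_1, …, P_N)`. -/
def blockDiag {N d : ℕ} (P : Fin N → Matrix (Fin d) (Fin d) ℝ) : PathMatrix N d :=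
  Matrix.of fun p q => if p.1 = q.1 then P p.1 p.2 q.2 else 0

/-- The space `ℒ(N, d)` of block lower triangular matrices. -/
def BlockLower (N d : ℕ) : Set (PathMatrix N d) :=
  {L | ∀ s t : Fin N, s < t → matBlock L s t = 0}

/-- The set `𝒪(N, d)` of block diagonal matrices with orthogonal diagonal blocks. -/
def BlockOrthogonal (N d : ℕ) : Set (PathMatrix N d) :=
  {Q | ∃ R : Fin N → Matrix (Fin d) (Fin d) ℝ,
    (∀ t, R t ∈ Matrix.orthogonalGroup (Fin d) ℝ) ∧ Q = blockDiag R}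

/-- The Frobenius norm `√(tr (C Cᵀ))`. -/
def frobNorm {m n : Type*} [Fintype m] [Fintype n] (C : Matrix m n ℝ) : ℝ :=
  Real.sqrt (C * Cᵀ).trace

/-- The nuclear norm `tr ((Cᵀ C)^{1/2})`. -/
def nuclearNorm {n : Type*} [Fintype n] [DecidableEq n] (C : Matrix n n ℝ) : ℝ :=
  (CFC.sqrt (Cᵀ * C)).trace

/-- The spectral norm: the operator norm for the Euclidean norm. -/
def specNorm {n : Type*} [Fintype n] [DecidableEq n] (C : Matrix n n ℝ) : ℝ :=
  ‖Matrix.toEuclideanCLM (𝕜 := ℝ) C‖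

/-- The set `𝒫(C)` of maximizers of `tr (C P)` over the matrices `P` of spectral norm at most 1. -/
def traceMaximizers {n : Type*} [Fintype n] [DecidableEq n] (C : Matrix n n ℝ) :
    Set (Matrix n n ℝ) :=
  {P | specNorm P ≤ 1 ∧ ∀ Q : Matrix n n ℝ, specNorm Q ≤ 1 → (C * Q).trace ≤ (C * P).trace}

/-- `C = U Σ Vᵀ` is a singular value decomposition, `Σ = diag σ` (in any order). -/
structure IsSVD {n : Type*} [Fintype n] [DecidableEq n] (C U : Matrix n n ℝ) (σ : n → ℝ)
    (V : Matrix n n ℝ) : Prop where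
  left_orthogonal : U ∈ Matrix.orthogonalGroup n ℝ
  right_orthogonal : V ∈ Matrix.orthogonalGroup n ℝ
  nonneg : ∀ i, 0 ≤ σ i
  eq_mul : C = U * Matrix.diagonal σ * Vᵀ

/-- The set of all `V₁ U₁ᵀ + V₀ K U₀ᵀ` with `‖K‖ ≤ 1`, where `U₁, V₁` (resp. `U₀, V₀`) consist of
the columns of `U, V` that belong to nonzero (resp. zero) singular values. -/
def svdMaximizers {n : Type*} [Fintype n] [DecidableEq n] (U : Matrix n n ℝ) (σ : n → ℝ)
    (V : Matrix n n ℝ) : Set (Matrix n n ℝ) :=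
  letI U₁ : Matrix n {i // σ i ≠ 0} ℝ := U.submatrix id Subtype.val
  letI V₁ : Matrix n {i // σ i ≠ 0} ℝ := V.submatrix id Subtype.val
  letI U₀ : Matrix n {i // σ i = 0} ℝ := U.submatrix id Subtype.val
  letI V₀ : Matrix n {i // σ i = 0} ℝ := V.submatrix id Subtype.val
  {P | ∃ K : Matrix {i // σ i = 0} {i // σ i = 0} ℝ,
    specNorm K ≤ 1 ∧ P = V₁ * U₁ᵀ + V₀ * K * U₀ᵀ}

/-- The distance `dist_AW` between Cholesky factors. -/
def distAW {N d : ℕ} (L M : PathMatrix N d) : ℝ :=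
  Real.sqrt (frobNorm L ^ 2 + frobNorm M ^ 2 - 2 * ∑ t, nuclearNorm (matBlock (Lᵀ * M) t t))

/-! ### Filtered Gaussian processes -/

lemma continuous_timeBlock {N d : ℕ} (t : Fin N) :
    Continuous (timeBlock t : PathSpace N d → EuclideanSpace ℝ (Fin d)) := by
  unfold timeBlock
  fun_prop

/-- The filtration generated by the canonical process `ε = (ε_1, …, ε_N)` on the path space. -/
def noiseFiltration (N d : ℕ) :
    Filtration (Fin N) (inferInstance : MeasurableSpace (PathSpace N d)) :=
  Filtration.natural (fun t => timeBlock t) fun t => (continuous_timeBlock t).stronglyMeasurable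

/-- The path `a + L ε` evaluated at the noise path `ε = x`. -/
def affinePath {N d : ℕ} (a : PathSpace N d) (L : PathMatrix N d) (x : PathSpace N d) :
    PathSpace N d :=
  a + Matrix.toEuclideanCLM (𝕜 := ℝ) L x

lemma affinePath_apply {N d : ℕ} (a : PathSpace N d) (L : PathMatrix N d) (x : PathSpace N d)
    (p : Fin N × Fin d) :
    affinePath a L x p = a p + ∑ s, ∑ j, L p (s, j) * x (s, j) := by
  simp [affinePath, Matrix.mulVec, dotProduct, Fintype.sum_prod_type]

lemma measurable_timeBlock_affinePath {N d : ℕ} {Ω : Type*} [MeasurableSpace Ω]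
    (a : PathSpace N d) (L : PathMatrix N d) (hL : L ∈ BlockLower N d) (f : Ω → PathSpace N d)
    (t : Fin N) (hf : ∀ s ≤ t, Measurable fun ω => timeBlock s (f ω)) :
    Measurable fun ω => timeBlock t (affinePath a L (f ω)) := by
  refine (PiLp.continuous_toLp 2 _).measurable.comp (measurable_pi_iff.2 fun i => ?_)
  simp only [affinePath_apply]
  refine measurable_const.add (Finset.measurable_sum _ fun s _ =>
    Finset.measurable_sum _ fun j _ => ?_)
  by_cases hs : s ≤ t
  · refine measurable_const.mul ?_
    have h2 : Measurable fun y : EuclideanSpace ℝ (Fin d) => y j := by fun_prop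
    exact h2.comp (hf s hs)
  · have h0 : L (t, i) (s, j) = 0 := congrFun (congrFun (hL t s (not_le.1 hs)) i) j
    simp only [h0, zero_mul]
    exact measurable_const

lemma adapted_affinePath {N d : ℕ} (a : PathSpace N d) (L : PathMatrix N d)
    (hL : L ∈ BlockLower N d) :
    Adapted (noiseFiltration N d) fun t x => timeBlock t (affinePath a L x) := fun t =>
  @measurable_timeBlock_affinePath N d _ (noiseFiltration N d t) a L hL id t fun _ hs =>
    Measurable.mono (comap_measurable _)
      (le_biSup (fun j => MeasurableSpace.comap (timeBlock j : PathSpace N d → _) _) hs) le_rfl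

lemma memLp_affinePath {N d : ℕ} (a : PathSpace N d) (L : PathMatrix N d) (t : Fin N) :
    MemLp (fun x => timeBlock t (affinePath a L x)) 2 (stdGaussian (PathSpace N d)) := by
  refine MemLp.of_eval_piLp fun i => ?_
  change MemLp (fun x => affinePath a L x (t, i)) 2 _
  have h : MemLp (affinePath a L) 2 (stdGaussian (PathSpace N d)) :=
    (memLp_const a).add
      ((Matrix.toEuclideanCLM (𝕜 := ℝ) L).comp_memLp' IsGaussian.memLp_two_id)
  exact h.eval_piLp (t, i)

/-- The filtered Gaussian process `𝔾^{a,L}`: the path space with the standard Gaussian measure,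
the filtration generated by the canonical process `ε`, and the process `X = a + L ε`. -/
abbrev filteredGaussian {N d : ℕ} (a : PathSpace N d) (L : BlockLower N d) :
    FilteredProcess N d where
  Ω := PathSpace N d
  mΩ := inferInstance
  P := stdGaussian (PathSpace N d)
  isProb := inferInstance
  ℱ := noiseFiltration N d
  X := fun t x => timeBlock t (affinePath a L.1 x)
  adapted := adapted_affinePath a L.1 L.2
  memLp := memLp_affinePath a L.1

/-- The centred Gaussian measure `π^P` on pairs `(ε^X, ε^Y)` of paths under which `ε^X` and `ε^Y`
have covariance matrix `I` and `E[ε^Y (ε^X)ᵀ] = P`: the covariance matrix of the stacked vector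
`(ε^X, ε^Y)` is `[I, Pᵀ; P, I]`, which is positive semidefinite when `P` has spectral norm at
most 1. -/
def gaussianCoupling {N d : ℕ} (P : PathMatrix N d) : Measure (PathSpace N d × PathSpace N d) :=
  (multivariateGaussian (0 : EuclideanSpace ℝ ((Fin N × Fin d) ⊕ (Fin N × Fin d)))
    (Matrix.fromBlocks 1 Pᵀ P 1)).map
    fun z => (WithLp.toLp 2 fun p => z (Sum.inl p), WithLp.toLp 2 fun p => z (Sum.inr p))

end AdaptedOT

end

open AdaptedOT

/-!
Under any coupling the quadratic cost of `a + L ε^X` and `b + M ε^Y` depends on the coupling only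
through the cross-covariance matrix `E[ε^Y (ε^X)ᵀ]` of the two noises (`transportCost_eq`), and the
dependence is linear. Bicausality forces this matrix to be block diagonal: given its own past, an
innovation `ε^X_s` is centred and independent of the past of `ε^Y`, so it is uncorrelated with
`ε^Y_t` for `t < s`, and symmetrically (`integral_fst_mul_snd_of_isBicausalCoupling`). Since both
noises are white, the diagonal blocks are contractions
(`IsWhiteCoupling.specNorm_crossBlock_le_one`). Conversely, each block diagonal contraction `P` is
the cross-covariance matrix of the Gaussian coupling `π^P`, whose pairs `(ε^X_t, ε^Y_t)` are
independent across time, and which is therefore bicausal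
(`isBicausalCoupling_gaussianCoupling`). The adapted transport problem thus splits into the `N`
problems of maximizing `tr ((LᵀM)_{t,t} P_t)` over contractions `P_t`.

Each of these is solved by a singular value decomposition `C = U Σ Vᵀ`: with `Q = Vᵀ P U`, one has
`tr (C P) = ∑ σ_i Q_ii` and `Q_ii ≤ 1`. Hence the maximum is the nuclear norm, and `P` is a maximizer
if and only if `Q_ii = 1` whenever `σ_i ≠ 0`; for a contraction `Q` this says that `Q` splits as an
identity block and an arbitrary contraction `K` (`IsSVD.traceMaximizers_eq`).

As the maximum is attained at orthogonal matrices, `dist_AW(L, M)` is the minimum of `‖L - M Q‖_F`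
over block diagonal orthogonal `Q` (`exists_distAW_eq`, `distAW_le_frobNorm`), that is, the
distance between orbits of a group acting by isometries, and so a pseudo-metric.
-/

namespace AdaptedOT

/-! ### Contractions and singular value decompositions -/

section Contractions

variable {n m : Type*} [Fintype n] [DecidableEq n] [Fintype m] [DecidableEq m]

/-- Contractions in terms of bilinear forms. This form of the condition is stable under orthogonal
changes of coordinates and block decompositions, and it is what Cauchy–Schwarz-type estimates of
covariances deliver. -/
theorem specNorm_le_one_iff (P : Matrix n n ℝ) :
    specNorm P ≤ 1 ↔ ∀ u v : n → ℝ, u ⬝ᵥ P *ᵥ v ≤ (u ⬝ᵥ u + v ⬝ᵥ v) / 2 := by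
  have hsq (w : EuclideanSpace ℝ n) : ‖w‖ ^ 2 = w.ofLp ⬝ᵥ w.ofLp := by
    rw [EuclideanSpace.real_norm_sq_eq, dotProduct]
    exact Finset.sum_congr rfl fun i _ => sq _
  unfold specNorm
  rw [ContinuousLinearMap.opNorm_le_iff zero_le_one]
  constructor
  · intro h u v
    have h1 := h (WithLp.toLp 2 v)
    rw [one_mul] at h1
    have h2 := pow_le_pow_left₀ (norm_nonneg _) h1 2
    rw [hsq, hsq, Matrix.ofLp_toEuclideanCLM] at h2
    have h3 : 0 ≤ (u - P *ᵥ v) ⬝ᵥ (u - P *ᵥ v) := by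
      simpa using dotProduct_star_self_nonneg (u - P *ᵥ v)
    rw [sub_dotProduct, dotProduct_sub, dotProduct_sub, dotProduct_comm (P *ᵥ v) u] at h3
    dsimp only at h2
    linarith
  · intro h x
    rw [one_mul]
    refine le_of_sq_le_sq ?_ (norm_nonneg _)
    rw [hsq, hsq, Matrix.ofLp_toEuclideanCLM]
    have := h (P *ᵥ x.ofLp) x.ofLp
    linarith

theorem specNorm_transpose_le_one {P : Matrix n n ℝ} (h : specNorm P ≤ 1) : specNorm Pᵀ ≤ 1 := by
  rw [specNorm_le_one_iff] at h ⊢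
  intro u v
  have := h v u
  rw [Matrix.mulVec_transpose, dotProduct_comm, ← Matrix.dotProduct_mulVec]
  linarith

theorem dotProduct_mulVec_orthogonal {U : Matrix n n ℝ} (hU : U ∈ Matrix.orthogonalGroup n ℝ)
    (u : n → ℝ) : (U *ᵥ u) ⬝ᵥ (U *ᵥ u) = u ⬝ᵥ u := by
  rw [Matrix.dotProduct_mulVec, Matrix.vecMul_mulVec,
    (Matrix.mem_orthogonalGroup_iff' n ℝ).1 hU, Matrix.vecMul_one]

theorem specNorm_conj_le_one {P U V : Matrix n n ℝ} (hP : specNorm P ≤ 1)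
    (hU : U ∈ Matrix.orthogonalGroup n ℝ) (hV : V ∈ Matrix.orthogonalGroup n ℝ) :
    specNorm (Uᵀ * P * V) ≤ 1 := by
  rw [specNorm_le_one_iff] at hP ⊢
  intro u v
  have := hP (U *ᵥ u) (V *ᵥ v)
  rwa [dotProduct_mulVec_orthogonal hU, dotProduct_mulVec_orthogonal hV,
    Matrix.dotProduct_mulVec, Matrix.vecMul_mulVec, Matrix.dotProduct_mulVec,
    Matrix.vecMul_vecMul, ← Matrix.dotProduct_mulVec] at this

theorem specNorm_one_le_one : specNorm (1 : Matrix n n ℝ) ≤ 1 := by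
  rw [specNorm_le_one_iff]
  intro u v
  have h3 : 0 ≤ (u - v) ⬝ᵥ (u - v) := by simpa using dotProduct_star_self_nonneg (u - v)
  rw [sub_dotProduct, dotProduct_sub, dotProduct_sub, dotProduct_comm v u] at h3
  rw [Matrix.one_mulVec]
  linarith

theorem transpose_mem_orthogonalGroup {U : Matrix n n ℝ} (hU : U ∈ Matrix.orthogonalGroup n ℝ) :
    Uᵀ ∈ Matrix.orthogonalGroup n ℝ := by
  rw [Matrix.mem_orthogonalGroup_iff, Matrix.transpose_transpose]
  exact (Matrix.mem_orthogonalGroup_iff' n ℝ).1 hU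

theorem specNorm_orthogonal_le_one {U : Matrix n n ℝ} (hU : U ∈ Matrix.orthogonalGroup n ℝ) :
    specNorm U ≤ 1 := by
  simpa using specNorm_conj_le_one specNorm_one_le_one (one_mem _) hU

theorem specNorm_submatrix_equiv_le_one {P : Matrix n n ℝ} (hP : specNorm P ≤ 1) (e : m ≃ n) :
    specNorm (P.submatrix e e) ≤ 1 := by
  rw [specNorm_le_one_iff] at hP ⊢
  intro u v
  have h := hP (u ∘ e.symm) (v ∘ e.symm)
  rw [comp_equiv_symm_dotProduct, comp_equiv_symm_dotProduct, comp_equiv_symm_dotProduct] at h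
  rw [Matrix.submatrix_mulVec_equiv]
  simpa [Function.comp_assoc] using h

theorem specNorm_fromBlocks_le_one_iff (K : Matrix n n ℝ) :
    specNorm (Matrix.fromBlocks K 0 0 (1 : Matrix m m ℝ)) ≤ 1 ↔ specNorm K ≤ 1 := by
  simp only [specNorm_le_one_iff]
  constructor
  · intro h u v
    simpa [Matrix.fromBlocks_mulVec] using h (Sum.elim u 0) (Sum.elim v 0)
  · intro h u v
    have h1 := h (u ∘ Sum.inl) (v ∘ Sum.inl)
    have h2 := (specNorm_le_one_iff _).1 (specNorm_one_le_one (n := m)) (u ∘ Sum.inr) (v ∘ Sum.inr)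
    rw [Matrix.one_mulVec] at h2
    rw [← Sum.elim_comp_inl_inr u, ← Sum.elim_comp_inl_inr v]
    simp only [Matrix.fromBlocks_mulVec, sumElim_dotProduct_sumElim, Sum.elim_comp_inl,
      Sum.elim_comp_inr, Matrix.zero_mulVec, Matrix.one_mulVec, add_zero, zero_add]
    linarith

theorem apply_self_le_one {Q : Matrix n n ℝ} (hQ : specNorm Q ≤ 1) (i : n) : Q i i ≤ 1 := by
  have := (specNorm_le_one_iff Q).1 hQ (Pi.single i 1) (Pi.single i 1)
  simp at this
  linarith

/-- A contraction with a diagonal entry `1` has no other nonzero entry in that row: otherwise a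
small perturbation of the basis vector would be expanded. -/
theorem apply_eq_zero_of_apply_self_eq_one {Q : Matrix n n ℝ} (hQ : specNorm Q ≤ 1) {i j : n}
    (hii : Q i i = 1) (hij : i ≠ j) : Q i j = 0 := by
  have h := (specNorm_le_one_iff Q).1 hQ (Pi.single i 1) (Pi.single i 1 + Pi.single j (Q i j))
  simp [Matrix.mulVec_add, hii, hij, hij.symm] at h
  nlinarith [sq_nonneg (Q i j)]

end Contractions

section SVD

variable {n : Type*} [Fintype n] [DecidableEq n]

theorem of_orthonormalBasis_mem (b : OrthonormalBasis n ℝ (EuclideanSpace ℝ n)) :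
    (Matrix.of fun i j => b j i) ∈ Matrix.orthogonalGroup n ℝ := by
  rw [Matrix.mem_orthogonalGroup_iff']
  ext i j
  have h := b.inner_eq_ite i j
  rw [EuclideanSpace.inner_eq_star_dotProduct, star_trivial, dotProduct_comm] at h
  rw [Matrix.one_apply, ← h]
  rfl

theorem exists_isSVD (C : Matrix n n ℝ) : ∃ U σ V, IsSVD C U σ V := by
  have hH : (Cᵀ * C).PosSemidef := by
    simpa [Matrix.conjTranspose_eq_transpose_of_trivial] using
      Matrix.posSemidef_conjTranspose_mul_self C
  set v := hH.isHermitian.eigenvectorBasis with hv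
  set lam := hH.isHermitian.eigenvalues with hlam
  have hlam0 : ∀ i, 0 ≤ lam i := hH.eigenvalues_nonneg
  set T : EuclideanSpace ℝ n → EuclideanSpace ℝ n := fun x => WithLp.toLp 2 (C *ᵥ x.ofLp) with hT
  have hTT (i j : n) : inner ℝ (T (v i)) (T (v j)) = if i = j then lam j else 0 := by
    have h1 : inner ℝ (T (v i)) (T (v j)) = inner ℝ (v i) (lam j • v j) := by
      simp only [hT, EuclideanSpace.inner_eq_star_dotProduct, star_trivial]
      rw [dotProduct_comm, Matrix.dotProduct_mulVec, Matrix.vecMul_mulVec,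
        ← Matrix.dotProduct_mulVec, hv, hH.isHermitian.mulVec_eigenvectorBasis, dotProduct_comm]
      rfl
    rw [h1, inner_smul_right, v.inner_eq_ite]
    simp
  -- Only the images of the singular vectors with nonzero singular value can be normalized; the
  -- resulting orthonormal family is then completed to a basis.
  have hw : Orthonormal ℝ
      ({i | lam i ≠ 0}.domRestrict fun i => (Real.sqrt (lam i))⁻¹ • T (v i)) := by
    rw [orthonormal_iff_ite]
    rintro ⟨i, hi⟩ ⟨j, hj⟩
    simp only [Set.domRestrict_apply, inner_smul_left, inner_smul_right, hTT, Subtype.mk.injEq]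
    split_ifs with hij
    · subst hij
      have h0 : Real.sqrt (lam i) ≠ 0 := (Real.sqrt_ne_zero (hlam0 i)).2 hi
      have h1 := Real.mul_self_sqrt (hlam0 i)
      simp only [conj_trivial]
      field_simp
      rw [sq, h1]
    · simp
  obtain ⟨b, hb⟩ := hw.exists_orthonormalBasis_extension_of_card_eq (by simp)
  have hTb (j : n) : T (v j) = Real.sqrt (lam j) • b j := by
    by_cases hj : lam j = 0
    · have : T (v j) = 0 := by
        rw [← inner_self_eq_zero (𝕜 := ℝ), hTT, if_pos rfl, hj]
      simp [this, hj]
    · rw [hb j hj, smul_smul, mul_inv_cancel₀ ((Real.sqrt_ne_zero (hlam0 j)).2 hj), one_smul]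
  refine ⟨Matrix.of fun i j => b j i, fun i => Real.sqrt (lam i), Matrix.of fun i j => v j i,
    of_orthonormalBasis_mem b, of_orthonormalBasis_mem v, fun i => Real.sqrt_nonneg _, ?_⟩
  have hCV : C * Matrix.of (fun i j => v j i)
      = Matrix.of (fun i j => b j i) * Matrix.diagonal fun i => Real.sqrt (lam i) := by
    ext i j
    have h1 := congrArg (fun x : EuclideanSpace ℝ n => x i) (hTb j)
    simp only [hT, PiLp.smul_apply, smul_eq_mul] at h1
    rw [Matrix.mul_diagonal, Matrix.of_apply, mul_comm (b j i), ← h1]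
    rfl
  rw [← hCV, Matrix.mul_assoc,
    (Matrix.mem_orthogonalGroup_iff n ℝ).1 (of_orthonormalBasis_mem v), Matrix.mul_one]

theorem nuclearNorm_eq_sum {C U V : Matrix n n ℝ} {σ : n → ℝ} (h : IsSVD C U σ V) :
    nuclearNorm C = ∑ i, σ i := by
  obtain ⟨hU, hV, hσ, rfl⟩ := h
  have hU' := (Matrix.mem_orthogonalGroup_iff' n ℝ).1 hU
  have hV' := (Matrix.mem_orthogonalGroup_iff' n ℝ).1 hV
  have hs : CFC.sqrt ((U * Matrix.diagonal σ * Vᵀ)ᵀ * (U * Matrix.diagonal σ * Vᵀ))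
      = V * Matrix.diagonal σ * Vᵀ := by
    refine CFC.sqrt_unique ?_ ?_
    · simp only [Matrix.transpose_mul, Matrix.transpose_transpose, Matrix.diagonal_transpose,
        Matrix.mul_assoc]
      rw [← Matrix.mul_assoc Vᵀ V, hV', ← Matrix.mul_assoc Uᵀ U, hU']
    · rw [Matrix.nonneg_iff_posSemidef]
      simpa [Matrix.conjTranspose_eq_transpose_of_trivial] using
        (Matrix.PosSemidef.diagonal hσ).mul_mul_conjTranspose_same V
  rw [nuclearNorm, hs, Matrix.trace_mul_comm, ← Matrix.mul_assoc, hV', Matrix.one_mul,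
    Matrix.trace_diagonal]

theorem trace_mul_eq_sum {C U V : Matrix n n ℝ} {σ : n → ℝ} (h : IsSVD C U σ V)
    (P : Matrix n n ℝ) : (C * P).trace = ∑ i, σ i * (Vᵀ * P * U) i i := by
  have h1 : (C * P).trace = (Matrix.diagonal σ * (Vᵀ * P * U)).trace := by
    rw [h.eq_mul, Matrix.mul_assoc, Matrix.mul_assoc, Matrix.trace_mul_comm]
    simp only [Matrix.mul_assoc]
  rw [h1, Matrix.trace]
  simp only [Matrix.diag_apply, Matrix.diagonal_mul]

/-- Duality between the nuclear norm and the spectral norm. -/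
theorem trace_mul_le_nuclearNorm (C : Matrix n n ℝ) {P : Matrix n n ℝ} (hP : specNorm P ≤ 1) :
    (C * P).trace ≤ nuclearNorm C := by
  obtain ⟨U, σ, V, h⟩ := exists_isSVD C
  rw [trace_mul_eq_sum h, nuclearNorm_eq_sum h]
  exact Finset.sum_le_sum fun i _ => mul_le_of_le_one_right (h.nonneg i)
    (apply_self_le_one (specNorm_conj_le_one hP h.right_orthogonal h.left_orthogonal) i)

theorem IsSVD.mul_transpose_mem {C U V : Matrix n n ℝ} {σ : n → ℝ} (h : IsSVD C U σ V) :
    V * Uᵀ ∈ Matrix.orthogonalGroup n ℝ :=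
  mul_mem h.right_orthogonal (transpose_mem_orthogonalGroup h.left_orthogonal)

theorem IsSVD.trace_mul_eq_nuclearNorm {C U V : Matrix n n ℝ} {σ : n → ℝ} (h : IsSVD C U σ V) :
    (C * (V * Uᵀ)).trace = nuclearNorm C := by
  have h1 : Vᵀ * (V * Uᵀ) * U = 1 := by
    rw [← Matrix.mul_assoc, (Matrix.mem_orthogonalGroup_iff' n ℝ).1 h.right_orthogonal,
      Matrix.one_mul, (Matrix.mem_orthogonalGroup_iff' n ℝ).1 h.left_orthogonal]
  rw [trace_mul_eq_sum h, nuclearNorm_eq_sum h, h1]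
  simp

theorem mem_traceMaximizers_iff {C P : Matrix n n ℝ} :
    P ∈ traceMaximizers C ↔ specNorm P ≤ 1 ∧ (C * P).trace = nuclearNorm C := by
  obtain ⟨U, σ, V, h⟩ := exists_isSVD C
  refine and_congr_right fun hP => ⟨fun hmax => ?_, fun heq Q hQ => ?_⟩
  · refine le_antisymm (trace_mul_le_nuclearNorm C hP) ?_
    rw [← h.trace_mul_eq_nuclearNorm]
    exact hmax _ (specNorm_orthogonal_le_one h.mul_transpose_mem)
  · rw [heq]
    exact trace_mul_le_nuclearNorm C hQ

theorem exists_mem_traceMaximizers (C : Matrix n n ℝ) :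
    ∃ P, P ∈ traceMaximizers C := by
  obtain ⟨U, σ, V, h⟩ := exists_isSVD C
  exact ⟨V * Uᵀ, mem_traceMaximizers_iff.2
    ⟨specNorm_orthogonal_le_one h.mul_transpose_mem, h.trace_mul_eq_nuclearNorm⟩⟩

theorem IsSVD.mem_traceMaximizers_iff {C U V P : Matrix n n ℝ} {σ : n → ℝ} (h : IsSVD C U σ V) :
    P ∈ traceMaximizers C ↔ specNorm P ≤ 1 ∧ ∀ i, σ i ≠ 0 → (Vᵀ * P * U) i i = 1 := by
  rw [AdaptedOT.mem_traceMaximizers_iff, trace_mul_eq_sum h, nuclearNorm_eq_sum h]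
  refine and_congr_right fun hP => ?_
  have hle i := apply_self_le_one (specNorm_conj_le_one hP h.right_orthogonal h.left_orthogonal) i
  rw [Finset.sum_eq_sum_iff_of_le fun i _ => mul_le_of_le_one_right (h.nonneg i) (hle i)]
  refine forall_congr' fun i => ?_
  by_cases hi : σ i = 0 <;> simp [hi]

/-- In the coordinates given by the singular vectors, the maximizers are the contractions that are
the identity on the span of the singular vectors with nonzero singular value. -/
theorem IsSVD.traceMaximizers_eq {C U V : Matrix n n ℝ} {σ : n → ℝ} (h : IsSVD C U σ V) :
    traceMaximizers C = svdMaximizers U σ V := by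
  classical
  have hU := (Matrix.mem_orthogonalGroup_iff' n ℝ).1 h.left_orthogonal
  have hV := (Matrix.mem_orthogonalGroup_iff' n ℝ).1 h.right_orthogonal
  have hU2 := (Matrix.mem_orthogonalGroup_iff n ℝ).1 h.left_orthogonal
  have hV2 := (Matrix.mem_orthogonalGroup_iff n ℝ).1 h.right_orthogonal
  let e : {i // σ i = 0} ⊕ {i // σ i ≠ 0} ≃ n := Equiv.sumCompl fun i => σ i = 0
  have hform (K : Matrix {i // σ i = 0} {i // σ i = 0} ℝ) :
      V * (Matrix.fromBlocks K 0 0 1).submatrix e.symm e.symm * Uᵀ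
        = V.submatrix id (Subtype.val : {i // σ i ≠ 0} → n)
            * (U.submatrix id (Subtype.val : {i // σ i ≠ 0} → n))ᵀ
          + V.submatrix id (Subtype.val : {i // σ i = 0} → n) * K
            * (U.submatrix id (Subtype.val : {i // σ i = 0} → n))ᵀ := by
    have hcols (W : Matrix n n ℝ) : W.submatrix id e
        = Matrix.fromCols (W.submatrix id (Subtype.val : {i // σ i = 0} → n))
          (W.submatrix id (Subtype.val : {i // σ i ≠ 0} → n)) := by
      ext i (j | j) <;> rfl
    have h1 : V * (Matrix.fromBlocks K 0 0 1).submatrix e.symm e.symm * Uᵀ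
        = V.submatrix id e * Matrix.fromBlocks K 0 0 (1 : Matrix {i // σ i ≠ 0} {i // σ i ≠ 0} ℝ)
          * (U.submatrix id e)ᵀ := by
      have := Matrix.submatrix_mul_equiv V
        ((Matrix.fromBlocks K 0 0 1).submatrix e.symm e.symm) id e e
      simp only [Matrix.submatrix_submatrix, Equiv.symm_comp_self, Matrix.submatrix_id_id] at this
      rw [this, Matrix.transpose_submatrix, Matrix.submatrix_mul_equiv, Matrix.submatrix_id_id]
    rw [h1, hcols, hcols, Matrix.transpose_fromCols, Matrix.fromCols_mul_fromBlocks,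
      Matrix.fromCols_mul_fromRows]
    simp [add_comm]
  ext P
  rw [h.mem_traceMaximizers_iff]
  constructor
  · rintro ⟨hP, hdiag⟩
    set Q := Vᵀ * P * U with hQ
    have hQ1 : specNorm Q ≤ 1 := specNorm_conj_le_one hP h.right_orthogonal h.left_orthogonal
    have hrow {i j : n} (hi : σ i ≠ 0) (hij : i ≠ j) : Q i j = 0 :=
      apply_eq_zero_of_apply_self_eq_one hQ1 (hdiag i hi) hij
    have hcol {i j : n} (hi : σ i ≠ 0) (hij : i ≠ j) : Q j i = 0 :=
      apply_eq_zero_of_apply_self_eq_one (Q := Qᵀ) (specNorm_transpose_le_one hQ1) (hdiag i hi) hij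
    have hblocks : Q.submatrix e e
        = Matrix.fromBlocks (Q.submatrix Subtype.val Subtype.val) 0 0 1 := by
      ext (i | i) (j | j)
      · rfl
      · exact hcol j.2 fun hji : j.1 = i.1 => j.2 (hji ▸ i.2)
      · exact hrow i.2 fun hij : i.1 = j.1 => i.2 (hij ▸ j.2)
      · change Q i.1 j.1 = (1 : Matrix _ _ ℝ) i j
        by_cases hij : i = j
        · subst hij
          simpa using hdiag i.1 i.2
        · rw [Matrix.one_apply_ne hij]
          exact hrow i.2 fun h' => hij (Subtype.ext h')
    refine ⟨Q.submatrix Subtype.val Subtype.val, ?_, ?_⟩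
    · rw [← specNorm_fromBlocks_le_one_iff (m := {i // σ i ≠ 0}), ← hblocks]
      exact specNorm_submatrix_equiv_le_one hQ1 e
    · rw [← hform, ← hblocks, Matrix.submatrix_submatrix, Equiv.self_comp_symm,
        Matrix.submatrix_id_id, hQ]
      simp only [Matrix.mul_assoc, hU2, Matrix.mul_one]
      rw [← Matrix.mul_assoc, hV2, Matrix.one_mul]
  · rintro ⟨K, hK, rfl⟩
    rw [← hform]
    constructor
    · have h1 := specNorm_submatrix_equiv_le_one
        ((specNorm_fromBlocks_le_one_iff (m := {i // σ i ≠ 0}) K).2 hK) e.symm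
      simpa using specNorm_conj_le_one h1 (transpose_mem_orthogonalGroup h.right_orthogonal)
        (transpose_mem_orthogonalGroup h.left_orthogonal)
    · intro i hi
      have h2 : Vᵀ * (V * (Matrix.fromBlocks K 0 0 1).submatrix e.symm e.symm * Uᵀ) * U
          = (Matrix.fromBlocks K 0 0 1).submatrix e.symm e.symm := by
        simp only [Matrix.mul_assoc, hU, Matrix.mul_one]
        rw [← Matrix.mul_assoc, hV, Matrix.one_mul]
      rw [h2, Matrix.submatrix_apply,
        show e.symm i = Sum.inr ⟨i, hi⟩ from Equiv.sumCompl_symm_apply_of_neg (p := fun i => σ i = 0) hi]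
      simp

end SVD

/-! ### Block diagonal matrices and the pseudo-metric -/

section BlockDiagonal

variable {N d : ℕ}

theorem blockDiag_mul (P Q : Fin N → Matrix (Fin d) (Fin d) ℝ) :
    blockDiag P * blockDiag Q = blockDiag fun t => P t * Q t := by
  ext ⟨s, i⟩ ⟨t, j⟩
  simp only [blockDiag, Matrix.mul_apply, Matrix.of_apply, Fintype.sum_prod_type]
  rw [Finset.sum_eq_single s (fun r _ hr => by simp [hr.symm]) (by simp)]
  by_cases h : s = t <;> simp [h]

theorem blockDiag_transpose (P : Fin N → Matrix (Fin d) (Fin d) ℝ) :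
    (blockDiag P)ᵀ = blockDiag fun t => (P t)ᵀ := by
  ext ⟨s, i⟩ ⟨t, j⟩
  by_cases h : s = t
  · subst h; simp [blockDiag]
  · simp [blockDiag, h, Ne.symm h]

theorem blockDiag_one : blockDiag (fun _ : Fin N => (1 : Matrix (Fin d) (Fin d) ℝ)) = 1 := by
  ext ⟨s, i⟩ ⟨t, j⟩
  by_cases h : s = t <;> simp [blockDiag, Matrix.one_apply, h]

theorem sum_mul_blockDiag (C : PathMatrix N d) (P : Fin N → Matrix (Fin d) (Fin d) ℝ) :
    ∑ p, ∑ q, C p q * blockDiag P q p = ∑ t, (matBlock C t t * P t).trace := by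
  simp only [Fintype.sum_prod_type, Matrix.trace, Matrix.diag_apply, Matrix.mul_apply, blockDiag,
    matBlock, Matrix.of_apply]
  refine Finset.sum_congr rfl fun t _ => Finset.sum_congr rfl fun i _ => ?_
  rw [Finset.sum_eq_single t (fun r _ hr => by simp [hr]) (by simp)]
  simp

theorem trace_mul_blockDiag (C : PathMatrix N d) (P : Fin N → Matrix (Fin d) (Fin d) ℝ) :
    (C * blockDiag P).trace = ∑ t, (matBlock C t t * P t).trace := by
  rw [← sum_mul_blockDiag]
  rfl

theorem specNorm_blockDiag_le_one {P : Fin N → Matrix (Fin d) (Fin d) ℝ}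
    (hP : ∀ t, specNorm (P t) ≤ 1) : specNorm (blockDiag P) ≤ 1 := by
  rw [specNorm_le_one_iff]
  intro u v
  have h1 : u ⬝ᵥ blockDiag P *ᵥ v
      = ∑ t, (fun i => u (t, i)) ⬝ᵥ P t *ᵥ (fun i => v (t, i)) := by
    simp only [dotProduct, Matrix.mulVec, blockDiag, Fintype.sum_prod_type, Matrix.of_apply]
    refine Finset.sum_congr rfl fun t _ => Finset.sum_congr rfl fun i _ => ?_
    rw [Finset.sum_eq_single t (fun r _ hr => by simp [hr.symm]) (by simp)]
    simp
  have h2 (w : Fin N × Fin d → ℝ) :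
      w ⬝ᵥ w = ∑ t, (fun i => w (t, i)) ⬝ᵥ (fun i => w (t, i)) := by
    simp only [dotProduct, Fintype.sum_prod_type]
  rw [h1, h2, h2, ← Finset.sum_add_distrib, Finset.sum_div]
  exact Finset.sum_le_sum fun t _ => (specNorm_le_one_iff _).1 (hP t) _ _

theorem blockDiag_mem_orthogonalGroup {P : Fin N → Matrix (Fin d) (Fin d) ℝ}
    (hP : ∀ t, P t ∈ Matrix.orthogonalGroup (Fin d) ℝ) :
    blockDiag P ∈ Matrix.orthogonalGroup (Fin N × Fin d) ℝ := by
  rw [Matrix.mem_orthogonalGroup_iff, blockDiag_transpose, blockDiag_mul, ← blockDiag_one]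
  congr 1
  funext t
  exact (Matrix.mem_orthogonalGroup_iff _ ℝ).1 (hP t)

end BlockDiagonal

section FrobeniusNorm

variable {m n : Type*} [Fintype m] [Fintype n]

theorem trace_mul_transpose_nonneg (C : Matrix m n ℝ) : 0 ≤ (C * Cᵀ).trace := by
  simp only [Matrix.trace, Matrix.diag_apply, Matrix.mul_apply, Matrix.transpose_apply]
  exact Finset.sum_nonneg fun i _ => Finset.sum_nonneg fun j _ => mul_self_nonneg _

theorem frobNorm_sq (C : Matrix m n ℝ) : frobNorm C ^ 2 = (C * Cᵀ).trace :=
  Real.sq_sqrt (trace_mul_transpose_nonneg C)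

theorem frobNorm_nonneg (C : Matrix m n ℝ) : 0 ≤ frobNorm C := Real.sqrt_nonneg _

theorem frobNorm_eq_norm (C : Matrix m n ℝ) :
    frobNorm C = ‖(WithLp.toLp 2 fun p : m × n => C p.1 p.2 : EuclideanSpace ℝ (m × n))‖ := by
  rw [EuclideanSpace.norm_eq, frobNorm]
  simp [Matrix.trace, Matrix.mul_apply, Fintype.sum_prod_type, sq]

theorem frobNorm_add_le (C D : Matrix m n ℝ) : frobNorm (C + D) ≤ frobNorm C + frobNorm D := by
  simp only [frobNorm_eq_norm]
  exact norm_add_le (WithLp.toLp 2 fun p : m × n => C p.1 p.2 : EuclideanSpace ℝ (m × n))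
    (WithLp.toLp 2 fun p : m × n => D p.1 p.2)

theorem frobNorm_sub_comm (C D : Matrix m n ℝ) : frobNorm (C - D) = frobNorm (D - C) := by
  rw [frobNorm, frobNorm, ← neg_sub D C]
  rw [Matrix.transpose_neg, Matrix.neg_mul, Matrix.mul_neg, neg_neg]

theorem frobNorm_mul_orthogonal [DecidableEq n] (C : Matrix m n ℝ) {Q : Matrix n n ℝ}
    (hQ : Q ∈ Matrix.orthogonalGroup n ℝ) : frobNorm (C * Q) = frobNorm C := by
  rw [frobNorm, frobNorm, Matrix.transpose_mul, Matrix.mul_assoc, ← Matrix.mul_assoc Q,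
    (Matrix.mem_orthogonalGroup_iff n ℝ).1 hQ, Matrix.one_mul]

theorem frobNorm_sub_mul_orthogonal_sq [DecidableEq n] (L M : Matrix m n ℝ) {Q : Matrix n n ℝ}
    (hQ : Q ∈ Matrix.orthogonalGroup n ℝ) :
    frobNorm (L - M * Q) ^ 2 = frobNorm L ^ 2 + frobNorm M ^ 2 - 2 * (Lᵀ * M * Q).trace := by
  have h1 : (L * (M * Q)ᵀ).trace = (Lᵀ * M * Q).trace := by
    rw [← Matrix.trace_transpose, Matrix.transpose_mul, Matrix.transpose_transpose,
      Matrix.trace_mul_comm, Matrix.mul_assoc]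
  have h2 : ((M * Q) * Lᵀ).trace = (Lᵀ * M * Q).trace := by
    rw [Matrix.trace_mul_comm, Matrix.mul_assoc]
  rw [← frobNorm_mul_orthogonal M hQ, frobNorm_sq, frobNorm_sq, frobNorm_sq,
    Matrix.transpose_sub, Matrix.sub_mul, Matrix.mul_sub, Matrix.mul_sub]
  simp only [Matrix.trace_sub, h1, h2]
  ring

end FrobeniusNorm

section Metric

variable {N d : ℕ}

/-- The expression under the root in `dist_AW` is a squared Frobenius norm: by singular value
decompositions of the diagonal blocks, every nuclear norm is attained at an orthogonal matrix. -/
theorem exists_frobNorm_sub_mul_sq_eq (L M : PathMatrix N d) :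
    ∃ Q : Fin N → Matrix (Fin d) (Fin d) ℝ, (∀ t, Q t ∈ Matrix.orthogonalGroup (Fin d) ℝ) ∧
      frobNorm (L - M * blockDiag Q) ^ 2 = frobNorm L ^ 2 + frobNorm M ^ 2
        - 2 * ∑ t, nuclearNorm (matBlock (Lᵀ * M) t t) := by
  choose U σ V h using fun t => exists_isSVD (matBlock (Lᵀ * M) t t)
  have hQ t := (h t).mul_transpose_mem
  refine ⟨fun t => V t * (U t)ᵀ, hQ, ?_⟩
  rw [frobNorm_sub_mul_orthogonal_sq _ _ (blockDiag_mem_orthogonalGroup hQ), trace_mul_blockDiag]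
  simp only [(h _).trace_mul_eq_nuclearNorm]

theorem distAW_sq (L M : PathMatrix N d) :
    distAW L M ^ 2 = frobNorm L ^ 2 + frobNorm M ^ 2
      - 2 * ∑ t, nuclearNorm (matBlock (Lᵀ * M) t t) := by
  obtain ⟨Q, -, hQ⟩ := exists_frobNorm_sub_mul_sq_eq L M
  rw [distAW, Real.sq_sqrt]
  rw [← hQ]
  positivity

theorem distAW_nonneg (L M : PathMatrix N d) : 0 ≤ distAW L M := Real.sqrt_nonneg _

theorem exists_distAW_eq (L M : PathMatrix N d) :
    ∃ Q : Fin N → Matrix (Fin d) (Fin d) ℝ, (∀ t, Q t ∈ Matrix.orthogonalGroup (Fin d) ℝ) ∧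
      distAW L M = frobNorm (L - M * blockDiag Q) := by
  obtain ⟨Q, hQ, h⟩ := exists_frobNorm_sub_mul_sq_eq L M
  refine ⟨Q, hQ, ?_⟩
  rw [← distAW_sq] at h
  exact ((pow_left_inj₀ (frobNorm_nonneg _) (distAW_nonneg L M) two_ne_zero).1 h).symm

theorem distAW_le_frobNorm (L M : PathMatrix N d) {Q : Fin N → Matrix (Fin d) (Fin d) ℝ}
    (hQ : ∀ t, Q t ∈ Matrix.orthogonalGroup (Fin d) ℝ) :
    distAW L M ≤ frobNorm (L - M * blockDiag Q) := by
  refine le_of_sq_le_sq ?_ (frobNorm_nonneg _)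
  rw [distAW_sq, frobNorm_sub_mul_orthogonal_sq _ _ (blockDiag_mem_orthogonalGroup hQ),
    trace_mul_blockDiag]
  have := Finset.sum_le_sum fun t (_ : t ∈ Finset.univ) =>
    trace_mul_le_nuclearNorm (matBlock (Lᵀ * M) t t) (specNorm_orthogonal_le_one (hQ t))
  linarith

theorem distAW_self (L : PathMatrix N d) : distAW L L = 0 := by
  refine le_antisymm ?_ (distAW_nonneg L L)
  refine (distAW_le_frobNorm L L (Q := fun _ => 1) fun _ => one_mem _).trans_eq ?_
  rw [blockDiag_one, Matrix.mul_one, sub_self, frobNorm]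
  simp

theorem distAW_comm_le (L M : PathMatrix N d) : distAW L M ≤ distAW M L := by
  obtain ⟨Q, hQ, h⟩ := exists_distAW_eq M L
  refine (distAW_le_frobNorm L M fun t => transpose_mem_orthogonalGroup (hQ t)).trans_eq ?_
  have hB := blockDiag_mem_orthogonalGroup hQ
  rw [h, ← blockDiag_transpose, ← frobNorm_mul_orthogonal _ hB, Matrix.sub_mul, Matrix.mul_assoc,
    (Matrix.mem_orthogonalGroup_iff' _ ℝ).1 hB, Matrix.mul_one, frobNorm_sub_comm]

theorem distAW_comm (L M : PathMatrix N d) : distAW L M = distAW M L :=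
  le_antisymm (distAW_comm_le L M) (distAW_comm_le M L)

theorem distAW_triangle (L M R : PathMatrix N d) : distAW L R ≤ distAW L M + distAW M R := by
  obtain ⟨P, hP, h₁⟩ := exists_distAW_eq L M
  obtain ⟨Q, hQ, h₂⟩ := exists_distAW_eq M R
  have h := distAW_le_frobNorm L R (Q := fun t => Q t * P t) fun t => mul_mem (hQ t) (hP t)
  rw [← blockDiag_mul] at h
  have h₃ : L - R * (blockDiag Q * blockDiag P)
      = (L - M * blockDiag P) + (M - R * blockDiag Q) * blockDiag P := by
    rw [Matrix.sub_mul, Matrix.mul_assoc]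
    abel
  rw [h₃] at h
  refine h.trans ((frobNorm_add_le _ _).trans_eq ?_)
  rw [frobNorm_mul_orthogonal _ (blockDiag_mem_orthogonalGroup hP), h₁, h₂]

variable (N d) in
/-- The pseudo-metric `dist_AW` on the block lower triangular matrices. -/
@[reducible] noncomputable def blockLowerPseudoMetric : PseudoMetricSpace (BlockLower N d) where
  dist L M := distAW L.1 M.1
  dist_self L := distAW_self L.1
  dist_comm L M := distAW_comm L.1 M.1
  dist_triangle L M R := distAW_triangle L.1 M.1 R.1

theorem exists_quotient_metric : ∃ S : Setoid (BlockLower N d),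
    (∀ L M, S L M ↔ distAW L.1 M.1 = 0) ∧
      ∃ D : MetricSpace (Quotient S), ∀ L M : BlockLower N d,
        D.dist (Quotient.mk S L) (Quotient.mk S M) = distAW L.1 M.1 := by
  let I := blockLowerPseudoMetric N d
  exact ⟨@inseparableSetoid _ I.toUniformSpace.toTopologicalSpace,
    fun L M => @Metric.inseparable_iff _ I L M,
    @SeparationQuotient.instMetricSpace _ I, fun L M => rfl⟩

end Metric

/-! ### Conditional independence -/

section ConditionalIndependence

variable {Ω : Type*} {m m₁ m₂ : MeasurableSpace Ω} {mΩ : MeasurableSpace Ω} {μ : Measure Ω}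
  [IsProbabilityMeasure μ]

theorem CondIndepGiven.integral_mul_eq_zero [StandardBorelSpace Ω] (hm : m ≤ mΩ) (hm₁ : m₁ ≤ mΩ) (hm₂ : m₂ ≤ mΩ)
    (h : CondIndepGiven m m₁ m₂ μ) {f g : Ω → ℝ} (hf : Measurable[m₁] f) (hg : Measurable[m₂] g)
    (hf2 : MemLp f 2 μ) (hg2 : MemLp g 2 μ) (hf0 : μ[f | m] =ᵐ[μ] 0) :
    ∫ ω, f ω * g ω ∂μ = 0 := by
  have hf' : Measurable f := hf.mono hm₁ le_rfl
  have hg' : Measurable g := hg.mono hm₂ le_rfl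
  have hc : CondIndep m m₁ m₂ hm μ := (condIndep_iff m m₁ m₂ hm hm₁ hm₂ μ).2 h
  have hfg : CondIndepFun m hm f g μ := by
    rw [condIndepFun_iff_condIndep]
    exact condIndep_of_condIndep_of_le_left
      (condIndep_of_condIndep_of_le_right hc hg.comap_le) hf.comap_le
  have hker := ae_of_ae_trim hm ((condIndepFun_iff_map_prod_eq_prod_map_map hf' hg').1 hfg)
  have hint : Integrable (fun ω => f ω * g ω) μ := hf2.integrable_mul hg2
  have hzero : μ[fun ω => f ω * g ω | m] =ᵐ[μ] 0 := by
    filter_upwards [hker, hf0, condExp_ae_eq_integral_condExpKernel hm hint,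
      condExp_ae_eq_integral_condExpKernel hm (hf2.integrable one_le_two)] with ω h1 h2 h3 h4
    have hind : IndepFun f g (condExpKernel μ m ω) := by
      rw [indepFun_iff_map_prod_eq_prod_map_map hf'.aemeasurable hg'.aemeasurable]
      rwa [Kernel.map_apply _ (hf'.prodMk hg'), Kernel.prod_apply, Kernel.map_apply _ hf',
        Kernel.map_apply _ hg'] at h1
    rw [h3]
    refine (hind.integral_mul_eq_mul_integral hf'.aestronglyMeasurable
      hg'.aestronglyMeasurable).trans ?_
    rw [← h4, h2]
    simp
  rw [← integral_condExp hm, integral_congr_ae hzero]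
  simp

theorem condExp_inter_of_indep (hm : m ≤ mΩ) (hm₁ : m₁ ≤ mΩ) (hm₂ : m₂ ≤ mΩ)
    (h : Indep m₁ (m ⊔ m₂) μ) {A B : Set Ω} (hA : MeasurableSet[m₁] A)
    (hB : MeasurableSet[m₂] B) :
    μ⟦A ∩ B | m⟧ =ᵐ[μ] fun ω => μ.real A * (μ⟦B | m⟧) ω := by
  have hA' := hm₁ _ hA
  have hB' := hm₂ _ hB
  have hi (s : Set Ω) (hs : MeasurableSet s) : Integrable (s.indicator fun _ => (1 : ℝ)) μ :=
    (integrable_const 1).indicator hs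
  symm
  refine ae_eq_condExp_of_forall_setIntegral_eq hm (hi _ (hA'.inter hB'))
    (fun s _ _ => (integrable_condExp.const_mul _).integrableOn) (fun s hs _ => ?_)
    (stronglyMeasurable_condExp.const_mul _).aestronglyMeasurable
  have hs' := hm _ hs
  rw [integral_const_mul, setIntegral_condExp hm (hi _ hB') hs,
    setIntegral_indicator hB', setIntegral_indicator (hA'.inter hB')]
  simp only [setIntegral_const, smul_eq_mul, mul_one]
  have hsB : MeasurableSet[m ⊔ m₂] (s ∩ B) :=
    (le_sup_left (b := m₂) _ hs).inter (le_sup_right (a := m) _ hB)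
  have := (Indep_iff m₁ (m ⊔ m₂) μ).1 h A (s ∩ B) hA hsB
  rw [Set.inter_left_comm s A B, measureReal_def, measureReal_def, measureReal_def, this,
    ENNReal.toReal_mul]

/-- Adding independent information: if `m₁` is independent of `m ⊔ m₂`, then `m ⊔ m₁` and `m₂` are
conditionally independent given `m`. -/
theorem condIndepGiven_sup_of_indep [StandardBorelSpace Ω] (hm : m ≤ mΩ) (hm₁ : m₁ ≤ mΩ)
    (hm₂ : m₂ ≤ mΩ) (h : Indep m₁ (m ⊔ m₂) μ) : CondIndepGiven m (m ⊔ m₁) m₂ μ := by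
  refine (condIndep_iff m (m ⊔ m₁) m₂ hm (sup_le hm hm₁) hm₂ μ).1 ?_
  set p : Set (Set Ω) := Set.image2 (· ∩ ·) {s | MeasurableSet[m] s} {s | MeasurableSet[m₁] s}
    with hp
  have hpi : IsPiSystem p := by
    rintro _ ⟨s, hs, t, ht, rfl⟩ _ ⟨s', hs', t', ht', rfl⟩ -
    exact ⟨s ∩ s', MeasurableSet.inter (m := m) hs hs', t ∩ t',
      MeasurableSet.inter (m := m₁) ht ht', Set.inter_inter_inter_comm _ _ _ _⟩
  have hgen : m ⊔ m₁ = MeasurableSpace.generateFrom p := by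
    refine le_antisymm (sup_le ?_ ?_) (MeasurableSpace.generateFrom_le ?_)
    · exact fun s hs => MeasurableSpace.measurableSet_generateFrom
        ⟨s, hs, Set.univ, MeasurableSet.univ (m := m₁), Set.inter_univ s⟩
    · exact fun s hs => MeasurableSpace.measurableSet_generateFrom
        ⟨Set.univ, MeasurableSet.univ (m := m), s, hs, Set.univ_inter s⟩
    · rintro _ ⟨s, hs, t, ht, rfl⟩
      exact MeasurableSet.inter (le_sup_left (b := m₁) _ hs) (le_sup_right (a := m) _ ht)
  refine CondIndepSets.condIndep (p1 := p) (p2 := {s | MeasurableSet[m₂] s})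
    (sup_le hm hm₁) hm₂ hpi (@MeasurableSpace.isPiSystem_measurableSet _ m₂) hgen
    (@MeasurableSpace.generateFrom_measurableSet _ m₂).symm ?_
  refine (condIndepSets_iff m hm p {s | MeasurableSet[m₂] s} ?_ (fun s hs => hm₂ _ hs) μ).2 ?_
  · rintro _ ⟨s, hs, t, ht, rfl⟩
    exact (hm _ hs).inter (hm₁ _ ht)
  · rintro _ B ⟨s, hs, t, ht, rfl⟩ hB
    have hi (s : Set Ω) (hs : MeasurableSet s) : Integrable (s.indicator fun _ => (1 : ℝ)) μ :=
      (integrable_const 1).indicator hs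
    have e₁ : (s ∩ t ∩ B).indicator (fun _ => (1 : ℝ))
        = s.indicator ((t ∩ B).indicator fun _ => 1) := by
      rw [Set.inter_assoc, Set.indicator_indicator]
    have e₂ : (s ∩ t).indicator (fun _ => (1 : ℝ)) = s.indicator (t.indicator fun _ => 1) := by
      rw [Set.indicator_indicator]
    dsimp only
    rw [e₁, e₂]
    have h₁ := condExp_indicator (hi _ ((hm₁ _ ht).inter (hm₂ _ hB))) hs
    have h₂ := condExp_indicator (hi _ (hm₁ _ ht)) hs
    have h₃ := condExp_inter_of_indep hm hm₁ hm₂ h ht hB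
    have h₄ := condExp_inter_of_indep hm hm₁ hm₂ h ht (MeasurableSet.univ (m := m₂))
    rw [Set.inter_univ, Set.indicator_univ, condExp_const hm] at h₄
    filter_upwards [h₁, h₂, h₃, h₄] with ω h₁ h₂ h₃ h₄
    rw [Pi.mul_apply, h₁, h₂]
    by_cases hω : ω ∈ s
    · rw [Set.indicator_of_mem hω, Set.indicator_of_mem hω, h₃, h₄, mul_one]
    · rw [Set.indicator_of_notMem hω, Set.indicator_of_notMem hω, zero_mul]

end ConditionalIndependence

section Blocks

variable {Ω : Type*} {mΩ : MeasurableSpace Ω} {μ : Measure Ω} {N : ℕ}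

/-- The σ-algebra generated by the first random variables `X_s`, `s ≤ t`. -/
abbrev pastSigma {E : Type*} [MeasurableSpace E] (X : Fin N → Ω → E) (t : Fin N) :
    MeasurableSpace Ω := ⨆ s ≤ t, MeasurableSpace.comap (X s) inferInstance

theorem pastSigma_le {E : Type*} [MeasurableSpace E] {X : Fin N → Ω → E}
    (hX : ∀ s, Measurable (X s)) (t : Fin N) : pastSigma X t ≤ mΩ :=
  iSup₂_le fun s _ => (hX s).comap_le

/-- If the pairs `(X_t, Y_t)` are independent across time, then the whole path of `X` is
conditionally independent of the past of `Y` given the past of `X`. -/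
theorem condIndepGiven_pastSigma [StandardBorelSpace Ω] [IsProbabilityMeasure μ] [NeZero N] {E F : Type*} [MeasurableSpace E]
    [MeasurableSpace F] {X : Fin N → Ω → E} {Y : Fin N → Ω → F} (hX : ∀ s, Measurable (X s))
    (hY : ∀ s, Measurable (Y s)) (h : iIndepFun (fun s ω => (X s ω, Y s ω)) μ) (t : Fin N) :
    CondIndepGiven (pastSigma X t) (pastSigma X ⊤) (pastSigma Y t) μ := by
  have hle (s : Fin N) : MeasurableSpace.comap (fun ω => (X s ω, Y s ω)) inferInstance ≤ mΩ :=
    ((hX s).prodMk (hY s)).comap_le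
  have hdisj : Disjoint (Set.Ioi t) (Set.Iic t) := Set.disjoint_left.2 fun s hs hs' =>
    (not_le.2 (Set.mem_Ioi.1 hs)) (Set.mem_Iic.1 hs')
  have hind := indep_iSup_of_disjoint hle h.iIndep hdisj
  have hXle (s : Fin N) : MeasurableSpace.comap (X s) inferInstance
      ≤ MeasurableSpace.comap (fun ω => (X s ω, Y s ω)) inferInstance := by
    exact (MeasurableSpace.comap_prodMk (X s) (Y s)).symm ▸ le_sup_left
  have hYle (s : Fin N) : MeasurableSpace.comap (Y s) inferInstance
      ≤ MeasurableSpace.comap (fun ω => (X s ω, Y s ω)) inferInstance := by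
    exact (MeasurableSpace.comap_prodMk (X s) (Y s)).symm ▸ le_sup_right
  have hind' : Indep (⨆ s ∈ Set.Ioi t, MeasurableSpace.comap (X s) inferInstance)
      (pastSigma X t ⊔ pastSigma Y t) μ :=
    indep_of_indep_of_le_left (indep_of_indep_of_le_right hind
      (sup_le (iSup₂_mono fun s _ => hXle s) (iSup₂_mono fun s _ => hYle s)))
      (iSup₂_mono fun s _ => hXle s)
  have htop : pastSigma X ⊤
      = pastSigma X t ⊔ ⨆ s ∈ Set.Ioi t, MeasurableSpace.comap (X s) inferInstance := by
    refine le_antisymm (iSup₂_le fun s _ => ?_) (sup_le ?_ ?_)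
    · rcases le_or_gt s t with hs | hs
      · exact le_sup_of_le_left (le_iSup₂_of_le s hs le_rfl)
      · exact le_sup_of_le_right (le_iSup₂_of_le s hs le_rfl)
    · exact iSup₂_le fun s _ => le_iSup₂_of_le s le_top le_rfl
    · exact iSup₂_le fun s _ => le_iSup₂_of_le s le_top le_rfl
  rw [htop]
  exact condIndepGiven_sup_of_indep (pastSigma_le hX t) (iSup₂_le fun s _ => (hX s).comap_le)
    (pastSigma_le hY t) hind'

/-- Causality kills the correlation of an innovation `X_s` with the strict past of `Y`. -/
theorem CondIndepGiven.integral_mul_eq_zero_of_lt [StandardBorelSpace Ω]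
    [IsProbabilityMeasure μ] [NeZero N] {ι κ : Type*}
    {X : Fin N → Ω → ι → ℝ} {Y : Fin N → Ω → κ → ℝ} (hX : ∀ s, Measurable (X s))
    (hY : ∀ s, Measurable (Y s)) (hX2 : ∀ s i, MemLp (fun ω => X s ω i) 2 μ)
    (hY2 : ∀ s i, MemLp (fun ω => Y s ω i) 2 μ) (hX0 : ∀ s i, ∫ ω, X s ω i ∂μ = 0)
    (hind : iIndepFun X μ) {s t : Fin N}
    (h : CondIndepGiven (pastSigma X t) (pastSigma X ⊤) (pastSigma Y t) μ) (hts : t < s)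
    (i : ι) (j : κ) : ∫ ω, X s ω i * Y t ω j ∂μ = 0 := by
  have hcoord (s : Fin N) (i : ι) :
      Measurable[MeasurableSpace.comap (X s) inferInstance] fun ω => X s ω i :=
    (measurable_pi_apply i).comp (comap_measurable (X s))
  refine h.integral_mul_eq_zero (pastSigma_le hX t) (pastSigma_le hX ⊤) (pastSigma_le hY t)
    ((hcoord s i).mono (le_iSup₂_of_le s le_top le_rfl) le_rfl)
    (((measurable_pi_apply j).comp (comap_measurable (Y t))).mono
      (le_iSup₂_of_le t le_rfl le_rfl) le_rfl) (hX2 s i) (hY2 t j) ?_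
  have hdisj : Disjoint {s} (Set.Iic t) := Set.disjoint_singleton_left.2 fun hs => hts.not_ge hs
  have hI := indep_iSup_of_disjoint (fun s => (hX s).comap_le) hind.iIndep hdisj
  rw [iSup_singleton] at hI
  have := condExp_indep_eq (hX s).comap_le (pastSigma_le hX t)
    (hcoord s i).stronglyMeasurable hI
  rw [hX0] at this
  exact this

theorem integral_sum_mul_sum {ι κ : Type*} [Fintype ι] [Fintype κ] {f : ι → Ω → ℝ}
    {g : κ → Ω → ℝ} (hf : ∀ i, MemLp (f i) 2 μ) (hg : ∀ j, MemLp (g j) 2 μ) (u : ι → ℝ)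
    (v : κ → ℝ) :
    ∫ ω, (∑ i, u i * f i ω) * (∑ j, v j * g j ω) ∂μ
      = ∑ i, ∑ j, u i * v j * ∫ ω, f i ω * g j ω ∂μ := by
  have hint i j : Integrable (fun ω => u i * v j * (f i ω * g j ω)) μ :=
    ((hf i).integrable_mul (hg j)).const_mul _
  have hexp ω : (∑ i, u i * f i ω) * (∑ j, v j * g j ω)
      = ∑ i, ∑ j, u i * v j * (f i ω * g j ω) := by
    rw [Finset.sum_mul_sum]
    exact Finset.sum_congr rfl fun i _ => Finset.sum_congr rfl fun j _ => mul_mul_mul_comm ..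
  simp only [hexp]
  rw [integral_finsetSum _ fun i _ => integrable_finsetSum _ fun j _ => hint i j]
  refine Finset.sum_congr rfl fun i _ => ?_
  rw [integral_finsetSum _ fun j _ => hint i j]
  simp only [integral_const_mul]

end Blocks

/-! ### Couplings of standard Gaussian measures -/

section Couplings

variable {N d : ℕ}

/-- The block `x_t` of the first path of a pair, as a bare vector. -/
def fstBlock (t : Fin N) (ω : PathSpace N d × PathSpace N d) (i : Fin d) : ℝ := ω.1 (t, i)

/-- The block `y_t` of the second path of a pair, as a bare vector. -/
def sndBlock (t : Fin N) (ω : PathSpace N d × PathSpace N d) (i : Fin d) : ℝ := ω.2 (t, i)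

theorem measurable_fstBlock (t : Fin N) : Measurable (fstBlock t : _ → Fin d → ℝ) := by
  unfold fstBlock; fun_prop

theorem measurable_sndBlock (t : Fin N) : Measurable (sndBlock t : _ → Fin d → ℝ) := by
  unfold sndBlock; fun_prop

theorem comap_timeBlock {Ω : Type*} (t : Fin N) (f : Ω → PathSpace N d) :
    MeasurableSpace.comap (fun ω => timeBlock t (f ω)) inferInstance
      = MeasurableSpace.comap (fun ω i => f ω (t, i)) inferInstance := by
  apply le_antisymm
  · rw [← measurable_iff_comap_le]
    exact (PiLp.continuous_toLp 2 _).measurable.comp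
      (comap_measurable fun ω (i : Fin d) => f ω (t, i))
  · rw [← measurable_iff_comap_le]
    exact (PiLp.continuous_ofLp 2 _).measurable.comp (comap_measurable fun ω => timeBlock t (f ω))

theorem noiseFiltration_prod_bot (t : Fin N) :
    MeasurableSpace.prod (noiseFiltration N d t) (⊥ : MeasurableSpace (PathSpace N d))
      = pastSigma fstBlock t := by
  change MeasurableSpace.comap Prod.fst (⨆ s ≤ t, _) ⊔ MeasurableSpace.comap Prod.snd ⊥ = _
  simp only [MeasurableSpace.comap_bot, sup_bot_eq, MeasurableSpace.comap_iSup,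
    MeasurableSpace.comap_comp]
  exact iSup_congr fun s => iSup_congr fun _ => comap_timeBlock s Prod.fst

theorem bot_prod_noiseFiltration (t : Fin N) :
    MeasurableSpace.prod (⊥ : MeasurableSpace (PathSpace N d)) (noiseFiltration N d t)
      = pastSigma sndBlock t := by
  change MeasurableSpace.comap Prod.fst ⊥ ⊔ MeasurableSpace.comap Prod.snd (⨆ s ≤ t, _) = _
  simp only [MeasurableSpace.comap_bot, bot_sup_eq, MeasurableSpace.comap_iSup,
    MeasurableSpace.comap_comp]
  exact iSup_congr fun s => iSup_congr fun _ => comap_timeBlock s Prod.snd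

theorem isBicausalCoupling_iff [NeZero N] (a b : PathSpace N d) (L M : BlockLower N d)
    (π : Measure (PathSpace N d × PathSpace N d)) :
    IsBicausalCoupling (filteredGaussian a L) (filteredGaussian b M) π ↔
      IsProbabilityMeasure π ∧ π.fst = stdGaussian (PathSpace N d) ∧
      π.snd = stdGaussian (PathSpace N d) ∧
      (∀ t, CondIndepGiven (pastSigma fstBlock t) (pastSigma fstBlock ⊤)
        (pastSigma sndBlock t) π) ∧
      (∀ t, CondIndepGiven (pastSigma sndBlock t) (pastSigma sndBlock ⊤)
        (pastSigma fstBlock t) π) := by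
  simp only [← noiseFiltration_prod_bot, ← bot_prod_noiseFiltration]
  exact ⟨fun h => ⟨h.1, h.2, h.3, h.4, h.5⟩, fun ⟨h₁, h₂, h₃, h₄, h₅⟩ => ⟨h₁, h₂, h₃, h₄, h₅⟩⟩

theorem integral_sq_add_sub {Ω : Type*} {mΩ : MeasurableSpace Ω} {μ : Measure Ω}
    [IsProbabilityMeasure μ] {f g : Ω → ℝ} (hf : MemLp f 2 μ) (hg : MemLp g 2 μ) (c : ℝ) :
    ∫ ω, (c + f ω - g ω) ^ 2 ∂μ = c ^ 2 + ∫ ω, f ω ^ 2 ∂μ + ∫ ω, g ω ^ 2 ∂μ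
      + 2 * c * ∫ ω, f ω ∂μ - 2 * c * ∫ ω, g ω ∂μ - 2 * ∫ ω, f ω * g ω ∂μ := by
  have hf1 := hf.integrable one_le_two
  have hg1 := hg.integrable one_le_two
  have hfg : Integrable (fun ω => f ω * g ω) μ := hf.integrable_mul hg
  have e ω : (c + f ω - g ω) ^ 2
      = c ^ 2 + f ω ^ 2 + g ω ^ 2 + 2 * c * f ω - 2 * c * g ω - 2 * (f ω * g ω) := by ring
  have i1 : Integrable (fun ω => c ^ 2 + f ω ^ 2) μ := (integrable_const _).add hf.integrable_sq
  have i2 : Integrable (fun ω => c ^ 2 + f ω ^ 2 + g ω ^ 2) μ := i1.add hg.integrable_sq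
  have i3 : Integrable (fun ω => c ^ 2 + f ω ^ 2 + g ω ^ 2 + 2 * c * f ω) μ :=
    i2.add (hf1.const_mul _)
  have i4 : Integrable (fun ω => c ^ 2 + f ω ^ 2 + g ω ^ 2 + 2 * c * f ω - 2 * c * g ω) μ :=
    i3.sub (hg1.const_mul _)
  simp only [e]
  rw [integral_sub i4 (hfg.const_mul _), integral_sub i3 (hg1.const_mul _),
    integral_add i2 (hf1.const_mul _), integral_add i1 hg.integrable_sq,
    integral_add (integrable_const _) hf.integrable_sq, integral_const_mul, integral_const_mul,
    integral_const_mul]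
  simp

variable {ι : Type*} [Fintype ι]

theorem memLp_eval_stdGaussian (p : ι) :
    MemLp (fun x : EuclideanSpace ℝ ι => x p) 2 (stdGaussian (EuclideanSpace ℝ ι)) :=
  IsGaussian.memLp_two_id.eval_piLp p

theorem integral_eval_stdGaussian (p : ι) :
    ∫ x : EuclideanSpace ℝ ι, x p ∂stdGaussian (EuclideanSpace ℝ ι) = 0 :=
  integral_strongDual_stdGaussian (EuclideanSpace.proj p : EuclideanSpace ℝ ι →L[ℝ] ℝ)

theorem covariance_eval_stdGaussian [DecidableEq ι] (p q : ι) :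
    cov[fun x => x p, fun x => x q; stdGaussian (EuclideanSpace ℝ ι)]
      = (1 : Matrix ι ι ℝ) p q := by
  rw [← multivariateGaussian_zero_one, covariance_eval_multivariateGaussian Matrix.PosSemidef.one]

/-- A coupling of two standard Gaussian measures, with no causality constraint. -/
structure IsWhiteCoupling (π : Measure (EuclideanSpace ℝ ι × EuclideanSpace ℝ ι)) : Prop where
  isProb : IsProbabilityMeasure π
  fst_eq : π.fst = stdGaussian (EuclideanSpace ℝ ι)
  snd_eq : π.snd = stdGaussian (EuclideanSpace ℝ ι)

namespace IsWhiteCoupling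

variable {π : Measure (EuclideanSpace ℝ ι × EuclideanSpace ℝ ι)}

theorem memLp_fst (h : IsWhiteCoupling π) (p : ι) : MemLp (fun ω => ω.1 p) 2 π := by
  have := memLp_eval_stdGaussian p
  rw [← h.fst_eq, Measure.fst] at this
  exact this.comp_of_map measurable_fst.aemeasurable

theorem memLp_snd (h : IsWhiteCoupling π) (p : ι) : MemLp (fun ω => ω.2 p) 2 π := by
  have := memLp_eval_stdGaussian p
  rw [← h.snd_eq, Measure.snd] at this
  exact this.comp_of_map measurable_snd.aemeasurable

theorem integral_fst (h : IsWhiteCoupling π) (p : ι) : ∫ ω, ω.1 p ∂π = 0 := by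
  have := integral_eval_stdGaussian p
  rwa [← h.fst_eq, Measure.fst, integral_map measurable_fst.aemeasurable
    (by fun_prop)] at this

theorem integral_snd (h : IsWhiteCoupling π) (p : ι) : ∫ ω, ω.2 p ∂π = 0 := by
  have := integral_eval_stdGaussian p
  rwa [← h.snd_eq, Measure.snd, integral_map measurable_snd.aemeasurable
    (by fun_prop)] at this

theorem memLp_sum_fst (h : IsWhiteCoupling π) (u : ι → ℝ) :
    MemLp (fun ω => ∑ p, u p * ω.1 p) 2 π :=
  memLp_finsetSum _ fun p _ => (h.memLp_fst p).const_mul (u p)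

theorem memLp_sum_snd (h : IsWhiteCoupling π) (u : ι → ℝ) :
    MemLp (fun ω => ∑ p, u p * ω.2 p) 2 π :=
  memLp_finsetSum _ fun p _ => (h.memLp_snd p).const_mul (u p)

theorem integral_sum_fst (h : IsWhiteCoupling π) (u : ι → ℝ) :
    ∫ ω, ∑ p, u p * ω.1 p ∂π = 0 := by
  have := h.isProb
  rw [integral_finsetSum _ fun p _ => ((h.memLp_fst p).integrable one_le_two).const_mul _]
  simp [integral_const_mul, h.integral_fst]

theorem integral_sum_snd (h : IsWhiteCoupling π) (u : ι → ℝ) :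
    ∫ ω, ∑ p, u p * ω.2 p ∂π = 0 := by
  have := h.isProb
  rw [integral_finsetSum _ fun p _ => ((h.memLp_snd p).integrable one_le_two).const_mul _]
  simp [integral_const_mul, h.integral_snd]

theorem integrable_sq_affine (h : IsWhiteCoupling π) (c : ℝ) (u v : ι → ℝ) :
    Integrable (fun ω => (c + ∑ p, u p * ω.1 p - ∑ q, v q * ω.2 q) ^ 2) π := by
  have := h.isProb
  exact (((memLp_const c).add (h.memLp_sum_fst u)).sub (h.memLp_sum_snd v)).integrable_sq

theorem covariance_fst_snd (h : IsWhiteCoupling π) (p q : ι) :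
    cov[fun ω => ω.1 p, fun ω => ω.2 q; π] = ∫ ω, ω.1 p * ω.2 q ∂π := by
  have := h.isProb
  rw [covariance_eq_sub (h.memLp_fst p) (h.memLp_snd q), h.integral_fst, zero_mul, sub_zero]
  rfl

variable [DecidableEq ι]

theorem covariance_fst (h : IsWhiteCoupling π) (p q : ι) :
    cov[fun ω => ω.1 p, fun ω => ω.1 q; π] = (1 : Matrix ι ι ℝ) p q := by
  have := covariance_eval_stdGaussian p q
  rwa [← h.fst_eq, Measure.fst, covariance_map (by fun_prop) (by fun_prop)
    measurable_fst.aemeasurable] at this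

theorem covariance_snd (h : IsWhiteCoupling π) (p q : ι) :
    cov[fun ω => ω.2 p, fun ω => ω.2 q; π] = (1 : Matrix ι ι ℝ) p q := by
  have := covariance_eval_stdGaussian p q
  rwa [← h.snd_eq, Measure.snd, covariance_map (by fun_prop) (by fun_prop)
    measurable_snd.aemeasurable] at this

theorem integral_fst_mul_fst (h : IsWhiteCoupling π) (p q : ι) :
    ∫ ω, ω.1 p * ω.1 q ∂π = (1 : Matrix ι ι ℝ) p q := by
  have := h.isProb
  rw [← h.covariance_fst, covariance_eq_sub (h.memLp_fst p) (h.memLp_fst q), h.integral_fst,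
    zero_mul, sub_zero]
  rfl

theorem integral_snd_mul_snd (h : IsWhiteCoupling π) (p q : ι) :
    ∫ ω, ω.2 p * ω.2 q ∂π = (1 : Matrix ι ι ℝ) p q := by
  have := h.isProb
  rw [← h.covariance_snd, covariance_eq_sub (h.memLp_snd p) (h.memLp_snd q), h.integral_snd,
    zero_mul, sub_zero]
  rfl

theorem integral_sq_sum_fst (h : IsWhiteCoupling π) (u : ι → ℝ) :
    ∫ ω, (∑ p, u p * ω.1 p) ^ 2 ∂π = u ⬝ᵥ u := by
  simp only [sq]
  rw [integral_sum_mul_sum h.memLp_fst h.memLp_fst]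
  simp [h.integral_fst_mul_fst, Matrix.one_apply, dotProduct]

theorem integral_sq_sum_snd (h : IsWhiteCoupling π) (u : ι → ℝ) :
    ∫ ω, (∑ p, u p * ω.2 p) ^ 2 ∂π = u ⬝ᵥ u := by
  simp only [sq]
  rw [integral_sum_mul_sum h.memLp_snd h.memLp_snd]
  simp [h.integral_snd_mul_snd, Matrix.one_apply, dotProduct]

theorem integral_sq_affine (h : IsWhiteCoupling π) (c : ℝ) (u v : ι → ℝ) :
    ∫ ω, (c + ∑ p, u p * ω.1 p - ∑ q, v q * ω.2 q) ^ 2 ∂π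
      = c ^ 2 + u ⬝ᵥ u + v ⬝ᵥ v - 2 * ∑ p, ∑ q, u p * v q * ∫ ω, ω.1 p * ω.2 q ∂π := by
  have := h.isProb
  rw [integral_sq_add_sub (h.memLp_sum_fst u) (h.memLp_sum_snd v), h.integral_sq_sum_fst,
    h.integral_sq_sum_snd, h.integral_sum_fst, h.integral_sum_snd,
    integral_sum_mul_sum h.memLp_fst h.memLp_snd]
  ring

end IsWhiteCoupling

end Couplings

section Cost

variable {N d : ℕ}

/-- The quadratic cost of a coupling depends only on the cross-covariance of the noises. -/
theorem transportCost_eq (a b : PathSpace N d) (L M : BlockLower N d)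
    {π : Measure (PathSpace N d × PathSpace N d)} (h : IsWhiteCoupling π) :
    transportCost (filteredGaussian a L) (filteredGaussian b M) π
        = ENNReal.ofReal (‖a - b‖ ^ 2 + frobNorm L.1 ^ 2 + frobNorm M.1 ^ 2
          - 2 * ∑ p, ∑ q, (L.1ᵀ * M.1) p q * ∫ ω, ω.1 p * ω.2 q ∂π) ∧
      0 ≤ ‖a - b‖ ^ 2 + frobNorm L.1 ^ 2 + frobNorm M.1 ^ 2
          - 2 * ∑ p, ∑ q, (L.1ᵀ * M.1) p q * ∫ ω, ω.1 p * ω.2 q ∂π := by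
  have hnorm (ω : PathSpace N d × PathSpace N d) :
      ‖affinePath a L.1 ω.1 - affinePath b M.1 ω.2‖ ^ 2
        = ∑ r, ((a r - b r) + ∑ p, L.1 r p * ω.1 p - ∑ q, M.1 r q * ω.2 q) ^ 2 := by
    rw [EuclideanSpace.real_norm_sq_eq]
    refine Finset.sum_congr rfl fun r _ => ?_
    rw [PiLp.sub_apply, affinePath_apply, affinePath_apply, Fintype.sum_prod_type,
      Fintype.sum_prod_type]
    ring
  have hr (r : Fin N × Fin d) := h.integrable_sq_affine (a r - b r) (fun p => L.1 r p)
    (fun q => M.1 r q)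
  have hint : Integrable (fun ω => ‖affinePath a L.1 ω.1 - affinePath b M.1 ω.2‖ ^ 2) π := by
    simp only [hnorm]
    exact integrable_finsetSum _ fun r _ => hr r
  have hfrob (A : PathMatrix N d) : frobNorm A ^ 2 = ∑ r, A r ⬝ᵥ A r := by
    rw [frobNorm_sq]; rfl
  have hval : ∫ ω, ‖affinePath a L.1 ω.1 - affinePath b M.1 ω.2‖ ^ 2 ∂π
      = ‖a - b‖ ^ 2 + frobNorm L.1 ^ 2 + frobNorm M.1 ^ 2
          - 2 * ∑ p, ∑ q, (L.1ᵀ * M.1) p q * ∫ ω, ω.1 p * ω.2 q ∂π := by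
    simp only [hnorm]
    rw [integral_finsetSum _ fun r _ => hr r, Finset.sum_congr rfl fun r _ =>
      h.integral_sq_affine (a r - b r) (fun p => L.1 r p) (fun q => M.1 r q)]
    simp only [Finset.sum_sub_distrib, Finset.sum_add_distrib,
      ← Finset.mul_sum]
    rw [hfrob, hfrob, EuclideanSpace.real_norm_sq_eq]
    congr 2
    rw [Finset.sum_comm]
    refine Finset.sum_congr rfl fun p _ => ?_
    rw [Finset.sum_comm]
    refine Finset.sum_congr rfl fun q _ => ?_
    rw [← Finset.sum_mul, Matrix.mul_apply]
    rfl
  refine ⟨?_, hval ▸ integral_nonneg fun ω => by positivity⟩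
  rw [← hval, ofReal_integral_eq_lintegral_ofReal hint (.of_forall fun ω => by positivity)]
  refine lintegral_congr fun ω => ?_
  rw [ENNReal.ofReal_pow (norm_nonneg _), ofReal_norm]
  rfl

theorem IsWhiteCoupling.iIndepFun_fstBlock {π : Measure (PathSpace N d × PathSpace N d)}
    (h : IsWhiteCoupling π) : iIndepFun (fstBlock (N := N) (d := d)) π := by
  have hG : HasGaussianLaw (fun ω : PathSpace N d × PathSpace N d => ω.1) π :=
    ⟨by change IsGaussian π.fst; rw [h.fst_eq]; infer_instance⟩
  let T : PathSpace N d →L[ℝ] (Fin N → Fin d → ℝ) :=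
    ContinuousLinearMap.pi fun t => ContinuousLinearMap.pi fun i => EuclideanSpace.proj (t, i)
  refine HasGaussianLaw.iIndepFun_of_covariance_eval
    (X := fun t i (ω : PathSpace N d × PathSpace N d) => ω.1 (t, i)) (hG.map T) ?_
  intro s t hst i j
  rw [h.covariance_fst, Matrix.one_apply_ne]
  simp [hst]

theorem IsWhiteCoupling.iIndepFun_sndBlock {π : Measure (PathSpace N d × PathSpace N d)}
    (h : IsWhiteCoupling π) : iIndepFun (sndBlock (N := N) (d := d)) π := by
  have hG : HasGaussianLaw (fun ω : PathSpace N d × PathSpace N d => ω.2) π :=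
    ⟨by change IsGaussian π.snd; rw [h.snd_eq]; infer_instance⟩
  let T : PathSpace N d →L[ℝ] (Fin N → Fin d → ℝ) :=
    ContinuousLinearMap.pi fun t => ContinuousLinearMap.pi fun i => EuclideanSpace.proj (t, i)
  refine HasGaussianLaw.iIndepFun_of_covariance_eval
    (X := fun t i (ω : PathSpace N d × PathSpace N d) => ω.2 (t, i)) (hG.map T) ?_
  intro s t hst i j
  rw [h.covariance_snd, Matrix.one_apply_ne]
  simp [hst]

/-- The cross-covariance `E[y_t x_tᵀ]` of the noises at time `t`, with rows indexed by `y`. -/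
noncomputable def crossBlock (π : Measure (PathSpace N d × PathSpace N d)) (t : Fin N) :
    Matrix (Fin d) (Fin d) ℝ :=
  Matrix.of fun i j => ∫ ω, ω.1 (t, j) * ω.2 (t, i) ∂π

theorem IsWhiteCoupling.specNorm_crossBlock_le_one
    {π : Measure (PathSpace N d × PathSpace N d)} (h : IsWhiteCoupling π) (t : Fin N) :
    specNorm (crossBlock π t) ≤ 1 := by
  have := h.isProb
  rw [specNorm_le_one_iff]
  intro u v
  -- The vectors `u`, `v` are extended by zero to the other time steps.
  have hext (w : Fin d → ℝ) (f : Fin N × Fin d → ℝ) :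
      ∑ p : Fin N × Fin d, (if p.1 = t then w p.2 else 0) * f p = ∑ i, w i * f (t, i) := by
    rw [Fintype.sum_prod_type, Finset.sum_eq_single t (fun r _ hr => by simp [hr]) (by simp)]
    simp
  have hx := h.memLp_sum_fst fun p => if p.1 = t then v p.2 else 0
  have hy := h.memLp_sum_snd fun p => if p.1 = t then u p.2 else 0
  have hx2 := h.integral_sq_sum_fst fun p => if p.1 = t then v p.2 else 0
  have hy2 := h.integral_sq_sum_snd fun p => if p.1 = t then u p.2 else 0
  simp only [hext, dotProduct, if_true] at hx hy hx2 hy2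
  have hxy : u ⬝ᵥ crossBlock π t *ᵥ v
      = ∫ ω, (∑ j, v j * ω.1 (t, j)) * (∑ i, u i * ω.2 (t, i)) ∂π := by
    rw [integral_sum_mul_sum (fun j => h.memLp_fst (t, j)) (fun i => h.memLp_snd (t, i)),
      Finset.sum_comm]
    simp only [dotProduct, Matrix.mulVec, crossBlock, Matrix.of_apply, Finset.mul_sum]
    refine Finset.sum_congr rfl fun i _ => Finset.sum_congr rfl fun j _ => ?_
    ring
  rw [hxy, dotProduct, dotProduct, ← hx2, ← hy2,
    ← integral_add hy.integrable_sq hx.integrable_sq, ← integral_div]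
  refine integral_mono (hx.integrable_mul hy) ((hy.integrable_sq.add hx.integrable_sq).div_const 2)
    fun ω => ?_
  dsimp only
  nlinarith [sq_nonneg ((∑ j, v j * ω.1 (t, j)) - ∑ i, u i * ω.2 (t, i))]

variable [NeZero N]

theorem isWhiteCoupling_of_isBicausalCoupling {a b : PathSpace N d} {L M : BlockLower N d}
    {π : Measure (PathSpace N d × PathSpace N d)}
    (h : IsBicausalCoupling (filteredGaussian a L) (filteredGaussian b M) π) :
    IsWhiteCoupling π := ⟨h.1, h.2, h.3⟩

/-- Bicausality makes the cross-covariance of the noises block diagonal. -/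
theorem integral_fst_mul_snd_of_isBicausalCoupling {a b : PathSpace N d} {L M : BlockLower N d}
    {π : Measure (PathSpace N d × PathSpace N d)}
    (h : IsBicausalCoupling (filteredGaussian a L) (filteredGaussian b M) π)
    (p q : Fin N × Fin d) :
    ∫ ω, ω.1 p * ω.2 q ∂π = blockDiag (crossBlock π) q p := by
  have hw := isWhiteCoupling_of_isBicausalCoupling h
  obtain ⟨hprob, -, -, hc, hac⟩ := (isBicausalCoupling_iff a b L M π).1 h
  obtain ⟨s, i⟩ := p
  obtain ⟨t, j⟩ := q
  rcases lt_trichotomy s t with hst | rfl | hst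
  · simp only [blockDiag, Matrix.of_apply, hst.ne', if_false]
    refine (integral_congr_ae (.of_forall fun ω => mul_comm _ _)).trans ?_
    exact (hac s).integral_mul_eq_zero_of_lt measurable_sndBlock measurable_fstBlock
      (fun s i => hw.memLp_snd (s, i)) (fun s i => hw.memLp_fst (s, i))
      (fun s i => hw.integral_snd (s, i)) hw.iIndepFun_sndBlock hst j i
  · simp [blockDiag, crossBlock]
  · simp only [blockDiag, Matrix.of_apply, hst.ne, if_false]
    exact (hc t).integral_mul_eq_zero_of_lt measurable_fstBlock measurable_sndBlock
      (fun s i => hw.memLp_fst (s, i)) (fun s i => hw.memLp_snd (s, i))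
      (fun s i => hw.integral_fst (s, i)) hw.iIndepFun_fstBlock hst i j

end Cost

/-! ### The Gaussian couplings `π^P` -/

section GaussianCoupling

variable {N d : ℕ}

theorem posSemidef_fromBlocks {n : Type*} [Fintype n] [DecidableEq n] {P : Matrix n n ℝ}
    (hP : specNorm P ≤ 1) : (Matrix.fromBlocks 1 Pᵀ P 1).PosSemidef := by
  rw [Matrix.posSemidef_iff_dotProduct_mulVec]
  refine ⟨?_, fun z => ?_⟩
  · rw [Matrix.IsHermitian, Matrix.conjTranspose_eq_transpose_of_trivial,
      Matrix.fromBlocks_transpose]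
    simp
  · have h1 := (specNorm_le_one_iff P).1 hP (-(z ∘ Sum.inr)) (z ∘ Sum.inl)
    rw [← Sum.elim_comp_inl_inr z, star_trivial]
    simp only [Matrix.fromBlocks_mulVec, sumElim_dotProduct_sumElim, Sum.elim_comp_inl,
      Sum.elim_comp_inr, Matrix.one_mulVec, dotProduct_add]
    rw [Matrix.mulVec_transpose, dotProduct_comm (z ∘ Sum.inl) (_ ᵥ* P),
      ← Matrix.dotProduct_mulVec]
    simp only [neg_dotProduct, dotProduct_neg, neg_neg] at h1
    linarith

/-- The continuous linear map that splits a stacked vector into its two paths. -/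
noncomputable def unstack (N d : ℕ) :
    EuclideanSpace ℝ ((Fin N × Fin d) ⊕ (Fin N × Fin d)) →L[ℝ] PathSpace N d × PathSpace N d :=
  LinearMap.toContinuousLinearMap
    { toFun := fun z => (WithLp.toLp 2 fun p => z (Sum.inl p), WithLp.toLp 2 fun p => z (Sum.inr p))
      map_add' := fun _ _ => rfl
      map_smul' := fun _ _ => rfl }

theorem gaussianCoupling_eq_map (P : PathMatrix N d) :
    gaussianCoupling P = (multivariateGaussian 0 (Matrix.fromBlocks 1 Pᵀ P 1)).map (unstack N d) :=
  rfl

instance isGaussian_gaussianCoupling (P : PathMatrix N d) : IsGaussian (gaussianCoupling P) := by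
  rw [gaussianCoupling_eq_map]
  infer_instance

theorem eq_stdGaussian_of_covariance {ι : Type*} [Fintype ι] [DecidableEq ι]
    {μ : Measure (EuclideanSpace ℝ ι)} [IsGaussian μ] (h0 : ∫ x, x ∂μ = 0)
    (h : ∀ p q, cov[fun x => x p, fun x => x q; μ] = (1 : Matrix ι ι ℝ) p q) :
    μ = stdGaussian (EuclideanSpace ℝ ι) := by
  refine IsGaussian.ext (h0.trans integral_id_stdGaussian.symm) ?_
  have hcov (ν : Measure (EuclideanSpace ℝ ι)) [IsGaussian ν] (p q : ι) :
      covarianceBilin ν (EuclideanSpace.basisFun ι ℝ p) (EuclideanSpace.basisFun ι ℝ q)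
        = cov[fun x => x p, fun x => x q; ν] := by
    rw [covarianceBilin_apply_eq_cov IsGaussian.memLp_two_id]
    simp [PiLp.inner_apply]
  have key (p q : ι) :
      covarianceBilin μ (EuclideanSpace.basisFun ι ℝ p) (EuclideanSpace.basisFun ι ℝ q)
        = covarianceBilin (stdGaussian (EuclideanSpace ℝ ι)) (EuclideanSpace.basisFun ι ℝ p)
          (EuclideanSpace.basisFun ι ℝ q) := by
    rw [hcov, hcov, h, covariance_eval_stdGaussian]
  refine ContinuousLinearMap.coe_injective ((EuclideanSpace.basisFun ι ℝ).toBasis.ext fun p => ?_)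
  refine ContinuousLinearMap.coe_injective ((EuclideanSpace.basisFun ι ℝ).toBasis.ext fun q => ?_)
  simpa using key p q

theorem isWhiteCoupling_gaussianCoupling {P : PathMatrix N d} (hP : specNorm P ≤ 1) :
    IsWhiteCoupling (gaussianCoupling P) where
  isProb := inferInstance
  fst_eq := by
    have hm := (unstack N d).continuous
    have hmap : (gaussianCoupling P).fst = (multivariateGaussian 0 (Matrix.fromBlocks 1 Pᵀ P 1)).map
        (ContinuousLinearMap.fst ℝ _ _ ∘L unstack N d) := by
      rw [gaussianCoupling_eq_map, Measure.fst, Measure.map_map measurable_fst hm.measurable]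
      rfl
    rw [hmap]
    refine eq_stdGaussian_of_covariance ?_ fun p q => ?_
    · rw [integral_map (by fun_prop) (by fun_prop),
        ContinuousLinearMap.integral_comp_comm _ IsGaussian.integrable_fun_id,
        integral_id_multivariateGaussian, map_zero]
    · rw [covariance_map (by fun_prop) (by fun_prop) (by fun_prop)]
      exact covariance_eval_multivariateGaussian (μ := 0) (posSemidef_fromBlocks hP)
        (Sum.inl p) (Sum.inl q)
  snd_eq := by
    have hm := (unstack N d).continuous
    have hmap : (gaussianCoupling P).snd = (multivariateGaussian 0 (Matrix.fromBlocks 1 Pᵀ P 1)).map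
        (ContinuousLinearMap.snd ℝ _ _ ∘L unstack N d) := by
      rw [gaussianCoupling_eq_map, Measure.snd, Measure.map_map measurable_snd hm.measurable]
      rfl
    rw [hmap]
    refine eq_stdGaussian_of_covariance ?_ fun p q => ?_
    · rw [integral_map (by fun_prop) (by fun_prop),
        ContinuousLinearMap.integral_comp_comm _ IsGaussian.integrable_fun_id,
        integral_id_multivariateGaussian, map_zero]
    · rw [covariance_map (by fun_prop) (by fun_prop) (by fun_prop)]
      exact covariance_eval_multivariateGaussian (μ := 0) (posSemidef_fromBlocks hP)
        (Sum.inr p) (Sum.inr q)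

theorem integral_fst_mul_snd_gaussianCoupling {P : PathMatrix N d} (hP : specNorm P ≤ 1)
    (p q : Fin N × Fin d) : ∫ ω, ω.1 p * ω.2 q ∂gaussianCoupling P = P q p := by
  rw [← (isWhiteCoupling_gaussianCoupling hP).covariance_fst_snd, gaussianCoupling_eq_map,
    covariance_map (by fun_prop) (by fun_prop) (unstack N d).continuous.aemeasurable]
  exact covariance_eval_multivariateGaussian (μ := 0) (posSemidef_fromBlocks hP)
    (Sum.inl p) (Sum.inr q)

/-- Under `π^P` with `P` block diagonal, distinct time steps are uncorrelated, hence independent. -/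
theorem iIndepFun_blocks_gaussianCoupling {P : Fin N → Matrix (Fin d) (Fin d) ℝ}
    (hP : specNorm (blockDiag P) ≤ 1) :
    iIndepFun (fun t ω => (fstBlock t ω, sndBlock t ω)) (gaussianCoupling (blockDiag P)) := by
  have hw := isWhiteCoupling_gaussianCoupling hP
  let T : PathSpace N d × PathSpace N d →L[ℝ] (Fin N → Fin d ⊕ Fin d → ℝ) :=
    ContinuousLinearMap.pi fun t => ContinuousLinearMap.pi
      (Sum.rec (fun i => (EuclideanSpace.proj (t, i) : PathSpace N d →L[ℝ] ℝ) ∘L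
          ContinuousLinearMap.fst ℝ _ _)
        (fun i => (EuclideanSpace.proj (t, i) : PathSpace N d →L[ℝ] ℝ) ∘L
          ContinuousLinearMap.snd ℝ _ _))
  have hG : HasGaussianLaw (fun ω : PathSpace N d × PathSpace N d => ω)
      (gaussianCoupling (blockDiag P)) :=
    ⟨by rw [Measure.map_id']; infer_instance⟩
  have hcross {s t : Fin N} (hst : s ≠ t) (i j : Fin d) :
      ∫ ω, ω.1 (s, i) * ω.2 (t, j) ∂gaussianCoupling (blockDiag P) = 0 := by
    rw [integral_fst_mul_snd_gaussianCoupling hP]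
    simp [blockDiag, hst.symm]
  have hind : iIndepFun (fun t ω (k : Fin d ⊕ Fin d) => T ω t k)
      (gaussianCoupling (blockDiag P)) := by
    refine HasGaussianLaw.iIndepFun_of_covariance_eval (X := fun t k ω => T ω t k) (hG.map T) ?_
    rintro s t hst (i | i) (j | j)
    · exact (hw.covariance_fst (s, i) (t, j)).trans (Matrix.one_apply_ne (by simp [hst]))
    · exact (hw.covariance_fst_snd (s, i) (t, j)).trans (hcross hst i j)
    · exact (covariance_comm _ _).trans
        ((hw.covariance_fst_snd (t, j) (s, i)).trans (hcross hst.symm j i))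
    · exact (hw.covariance_snd (s, i) (t, j)).trans (Matrix.one_apply_ne (by simp [hst]))
  exact hind.comp (fun _ w => (fun i => w (Sum.inl i), fun i => w (Sum.inr i)))
    fun _ => by fun_prop

theorem isBicausalCoupling_gaussianCoupling [NeZero N] (a b : PathSpace N d)
    (L M : BlockLower N d) {P : Fin N → Matrix (Fin d) (Fin d) ℝ}
    (hP : ∀ t, specNorm (P t) ≤ 1) :
    IsBicausalCoupling (filteredGaussian a L) (filteredGaussian b M)
      (gaussianCoupling (blockDiag P)) := by
  have hB := specNorm_blockDiag_le_one hP
  have hw := isWhiteCoupling_gaussianCoupling hB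
  have hind := iIndepFun_blocks_gaussianCoupling hB
  exact (isBicausalCoupling_iff a b L M _).2 ⟨hw.isProb, hw.fst_eq, hw.snd_eq,
    condIndepGiven_pastSigma measurable_fstBlock measurable_sndBlock hind,
    condIndepGiven_pastSigma measurable_sndBlock measurable_fstBlock
      (hind.comp (fun _ => Prod.swap) fun _ => measurable_swap)⟩

end GaussianCoupling

/-! ### Optimality -/

section Optimality

variable {N d : ℕ} (a b : PathSpace N d) (L M : BlockLower N d)

theorem transportCost_gaussianCoupling {P : Fin N → Matrix (Fin d) (Fin d) ℝ}
    (hP : ∀ t, specNorm (P t) ≤ 1) :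
    transportCost (filteredGaussian a L) (filteredGaussian b M) (gaussianCoupling (blockDiag P))
        = ENNReal.ofReal (‖a - b‖ ^ 2 + frobNorm L.1 ^ 2 + frobNorm M.1 ^ 2
          - 2 * ∑ t, (matBlock (L.1ᵀ * M.1) t t * P t).trace) ∧
      0 ≤ ‖a - b‖ ^ 2 + frobNorm L.1 ^ 2 + frobNorm M.1 ^ 2
          - 2 * ∑ t, (matBlock (L.1ᵀ * M.1) t t * P t).trace := by
  have hB := specNorm_blockDiag_le_one hP
  have := transportCost_eq a b L M (isWhiteCoupling_gaussianCoupling hB)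
  simpa only [integral_fst_mul_snd_gaussianCoupling hB, sum_mul_blockDiag] using this

theorem transportCost_gaussianCoupling_eq_iff {P : Fin N → Matrix (Fin d) (Fin d) ℝ}
    (hP : ∀ t, specNorm (P t) ≤ 1) :
    transportCost (filteredGaussian a L) (filteredGaussian b M) (gaussianCoupling (blockDiag P))
        = ENNReal.ofReal (‖a - b‖ ^ 2 + distAW L.1 M.1 ^ 2) ↔
      ∀ t, P t ∈ traceMaximizers (matBlock (L.1ᵀ * M.1) t t) := by
  obtain ⟨h1, h2⟩ := transportCost_gaussianCoupling a b L M hP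
  have h3 : ∑ t, (matBlock (L.1ᵀ * M.1) t t * P t).trace
        = ∑ t, nuclearNorm (matBlock (L.1ᵀ * M.1) t t) ↔
      ∀ t, P t ∈ traceMaximizers (matBlock (L.1ᵀ * M.1) t t) := by
    rw [Finset.sum_eq_sum_iff_of_le fun t _ => trace_mul_le_nuclearNorm _ (hP t)]
    simp only [mem_traceMaximizers_iff, hP, true_and, Finset.mem_univ, true_imp_iff]
  rw [h1, ENNReal.ofReal_eq_ofReal_iff h2 (by positivity), distAW_sq, ← h3]
  constructor <;> intro h <;> linarith

variable [NeZero N]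

theorem le_transportCost {π : Measure (PathSpace N d × PathSpace N d)}
    (h : IsBicausalCoupling (filteredGaussian a L) (filteredGaussian b M) π) :
    ENNReal.ofReal (‖a - b‖ ^ 2 + distAW L.1 M.1 ^ 2)
      ≤ transportCost (filteredGaussian a L) (filteredGaussian b M) π := by
  have hw := isWhiteCoupling_of_isBicausalCoupling h
  rw [(transportCost_eq a b L M hw).1, distAW_sq]
  refine ENNReal.ofReal_le_ofReal ?_
  simp only [integral_fst_mul_snd_of_isBicausalCoupling h, sum_mul_blockDiag]
  have := Finset.sum_le_sum fun t (_ : t ∈ Finset.univ) =>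
    trace_mul_le_nuclearNorm (matBlock (L.1ᵀ * M.1) t t) (hw.specNorm_crossBlock_le_one t)
  linarith

theorem AW2_eq : AW2 (filteredGaussian a L) (filteredGaussian b M)
    = ENNReal.ofReal (‖a - b‖ ^ 2 + distAW L.1 M.1 ^ 2) ^ (1 / 2 : ℝ) := by
  refine le_antisymm ?_ (le_iInf₂ fun π hπ =>
    ENNReal.rpow_le_rpow (le_transportCost a b L M hπ) (by norm_num))
  choose P hP using fun t => exists_mem_traceMaximizers (matBlock (L.1ᵀ * M.1) t t)
  rw [← (transportCost_gaussianCoupling_eq_iff a b L M fun t => (hP t).1).2 hP]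
  exact iInf₂_le _ (isBicausalCoupling_gaussianCoupling a b L M fun t => (hP t).1)

theorem isOptimalCoupling_gaussianCoupling_iff {P : Fin N → Matrix (Fin d) (Fin d) ℝ}
    (hP : ∀ t, specNorm (P t) ≤ 1) :
    IsOptimalCoupling (filteredGaussian a L) (filteredGaussian b M)
        (gaussianCoupling (blockDiag P)) ↔
      ∀ t, P t ∈ traceMaximizers (matBlock (L.1ᵀ * M.1) t t) := by
  rw [← transportCost_gaussianCoupling_eq_iff a b L M hP, IsOptimalCoupling, AW2_eq,
    (ENNReal.rpow_left_injective (by norm_num : (1 / 2 : ℝ) ≠ 0)).eq_iff]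
  exact and_iff_right (isBicausalCoupling_gaussianCoupling a b L M hP)

end Optimality

end AdaptedOT

theorem theorem3p3 (N d : ℕ) [NeZero N] [NeZero d] :
    -- the adapted distance between filtered Gaussian processes
    (∀ (a b : PathSpace N d) (L M : BlockLower N d),
      AW2 (filteredGaussian a L) (filteredGaussian b M) ^ 2
          = ENNReal.ofReal (‖a - b‖ ^ 2 + distAW L.1 M.1 ^ 2) ∧
      distAW L.1 M.1 ^ 2 = frobNorm L.1 ^ 2 + frobNorm M.1 ^ 2
          - 2 * ∑ t, nuclearNorm (matBlock (L.1ᵀ * M.1) t t)) ∧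
    -- `distAW` is a pseudo-metric on the block lower triangular matrices
    ((∀ L M : BlockLower N d, 0 ≤ distAW L.1 M.1) ∧
      (∀ L : BlockLower N d, distAW L.1 L.1 = 0) ∧
      (∀ L M : BlockLower N d, distAW L.1 M.1 = distAW M.1 L.1) ∧
      (∀ L M R : BlockLower N d, distAW L.1 R.1 ≤ distAW L.1 M.1 + distAW M.1 R.1)) ∧
    -- it induces a metric on the quotient by the relation `distAW L M = 0`
    (∃ S : Setoid (BlockLower N d), (∀ L M, S L M ↔ distAW L.1 M.1 = 0) ∧
      ∃ D : MetricSpace (Quotient S), ∀ L M : BlockLower N d,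
        D.dist (Quotient.mk S L) (Quotient.mk S M) = distAW L.1 M.1) ∧
    -- optimal Gaussian couplings
    (∀ (a b : PathSpace N d) (L M : BlockLower N d),
      (∃ π : Measure (PathSpace N d × PathSpace N d), IsGaussian π ∧
        IsOptimalCoupling (filteredGaussian a L) (filteredGaussian b M) π) ∧
      (∀ P : Fin N → Matrix (Fin d) (Fin d) ℝ, (∀ t, specNorm (P t) ≤ 1) →
        IsGaussian (gaussianCoupling (blockDiag P)) ∧
        IsBicausalCoupling (filteredGaussian a L) (filteredGaussian b M)
          (gaussianCoupling (blockDiag P)) ∧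
        (IsOptimalCoupling (filteredGaussian a L) (filteredGaussian b M)
            (gaussianCoupling (blockDiag P)) ↔
          ∀ t, P t ∈ traceMaximizers (matBlock (L.1ᵀ * M.1) t t))) ∧
      (∀ (U V : Fin N → Matrix (Fin d) (Fin d) ℝ) (σ : Fin N → Fin d → ℝ),
        (∀ t, IsSVD (matBlock (L.1ᵀ * M.1) t t) (U t) (σ t) (V t)) →
        (∀ t, traceMaximizers (matBlock (L.1ᵀ * M.1) t t) = svdMaximizers (U t) (σ t) (V t)) ∧
        blockDiag (fun t => V t * (U t)ᵀ) ∈ BlockOrthogonal N d ∧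
        IsOptimalCoupling (filteredGaussian a L) (filteredGaussian b M)
          (gaussianCoupling (blockDiag fun t => V t * (U t)ᵀ)))) := by
  refine ⟨fun a b L M => ⟨?_, distAW_sq L.1 M.1⟩, ⟨fun L M => distAW_nonneg L.1 M.1,
    fun L => distAW_self L.1, fun L M => distAW_comm L.1 M.1,
    fun L M R => distAW_triangle L.1 M.1 R.1⟩, exists_quotient_metric, fun a b L M => ⟨?_, ?_, ?_⟩⟩
  · rw [AW2_eq, ← ENNReal.rpow_natCast, ← ENNReal.rpow_mul]
    norm_num
  · choose P hP using fun t => exists_mem_traceMaximizers (matBlock (L.1ᵀ * M.1) t t)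
    exact ⟨gaussianCoupling (blockDiag P), inferInstance,
      (isOptimalCoupling_gaussianCoupling_iff a b L M fun t => (hP t).1).2 hP⟩
  · exact fun P hP => ⟨inferInstance, isBicausalCoupling_gaussianCoupling a b L M hP,
      isOptimalCoupling_gaussianCoupling_iff a b L M hP⟩
  · intro U V σ h
    have hQ t := (h t).mul_transpose_mem
    refine ⟨fun t => (h t).traceMaximizers_eq, ⟨_, hQ, rfl⟩,
      (isOptimalCoupling_gaussianCoupling_iff a b L M fun t =>
        specNorm_orthogonal_le_one (hQ t)).2 fun t => ?_⟩
    exact mem_traceMaximizers_iff.2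
      ⟨specNorm_orthogonal_le_one (hQ t), (h t).trace_mul_eq_nuclearNorm⟩
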